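/- **Conventions.** Modal propositions are built from atomic variables, $\bot,\top$ with $\wedge,\vee,\to,\square$. $\mathsf{IPC}_\square$ is intuitionistic propositional logic in this language (boxed formulas behave like atoms). $i\mathsf{K4}$ is $\mathsf{IPC}_\square$ plus $\square(A\to B)\to(\square A\to\square B)$, $\square A\to\square\square A$, necessitation and modus ponens. For finite sets, $\bigwedge\emptyset=\top$ and $\bigvee\emptyset=\bot$; the statement "$B=\bigwedge X$" is understood up to order, bracketing and repetition of conjuncts, similarly for $\bigvee$. *Box translation.* $p^\square=p\wedge\square p$ for atomic $p$, $\bot^\square=\bot$, $\top^\square=\top$, $(A\circ B)^\square=A^\square\circ B^\square$ for $\circ\in\{\wedge,\vee\}$, $(A\to B)^\square=(A^\square\to B^\square)\wedge\square(A^\square\to B^\square)$, $(\square A)^\square=\square(A^\square)$. *Brackets.* $[A]B$ and $[A]'B$ equal $B$ if $B$ is atomic, $\top$, $\bot$ or boxed; both commute with $\wedge,\vee$ in $B$; $[A](B_1\to B_2)=A\to(B_1\to B_2)$ and $[A]'(B_1\to B_2)=(A'\wedge B_1)\to B_2$, where $A'$ is $A$ with each occurrence of $B_1\to B_2$ replaced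 by $B_2$. For a finite set $Z$, $[A]Z=\bigvee\{[A]E: E\in Z\}$ and $[A]'Z=\bigvee\{[A]'E: E\in Z\}$. *Measure.* $I(D)$ is the set of subformulas of $D$ that are implications occurring outside every box, $\mathfrak i(D)=\max\{|I(E)|:E\in I(D)\}$ (with $\max\emptyset=0$), $\mathfrak c(D)$ the number of occurrences of connectives outside boxes (boxed formulas counting as atoms), $\mathfrak d(D)$ the maximal nesting of boxes, and $\mathfrak o(D)=(\mathfrak d(D),\mathfrak i(D),\mathfrak c(D))$, ordered lexicographically. *NNIL-algorithm* (non-deterministic), computing $A^*$: (1) if $A$ is atomic, $\top$, $\bot$ or boxed, $A^*=A$; (2) $(B\wedge C)^*=B^*\wedge C^*$; (3) $(B\vee C)^*=B^*\vee C^*$; (4) for $A=B\to C$ (an occurrence being *outer* if it is outside the scope of implications and boxes): (a) if $C$ has an outer occurrence of a conjunction $D\wedge E$, let $C_1,C_2$ be $C$ with this occurrence replaced by $D$, respectively $E$, and put $A^*=(B\to C_1)^*\wedge(B\to C_2)^*$; (b) if $B$ has an outer occurrence of a disjunction $D\vee E$, let $B_1,B_2$ be $B$ with this occurrence replaced by $D$,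 respectively $E$, and put $A^*=(B_1\to C)^*\wedge(B_2\to C)^*$; (c) if $B=\bigwedge X$, $C=\bigvee Y$ with $X,Y$ finite sets of implications, atoms, $\top$, $\bot$ and boxed formulas: (i) if $X$ contains an atomic or boxed $p$, $A^*=p\to(\bigwedge(X\setminus\{p\})\to C)^*$; (ii) if $\top\in X$, $A^*=(\bigwedge(X\setminus\{\top\})\to C)^*$; (iii) if $\bot\in X$, $A^*=\top$; (iv) if $X$ contains only implications, put $B\downarrow D=\bigwedge((X\setminus\{D\})\cup\{F\})$ for $D=(E\to F)\in X$, $Z=\{E: E\to F\in X\}\cup\{C\}$, $A_0=[B]Z$, $A_1=[B]'Z$; then $A^*=\bigwedge\{((B\downarrow D)\to C)^*:D\in X\}\wedge A_j^*$, where $j=0$ if $\mathfrak o(A_0)<\mathfrak o(A)$ and $j=1$ otherwise. *TNNIL-approximation.* Write $A=A'[p_1|\square B_1,\dots,p_n|\square B_n]$, where $\square B_1,\dots,\square B_n$ are the distinct outermost boxed subformulas of $A$, $p_1,\dots,p_n$ are distinct fresh variables and $A'$ is non-modal. Then, recursively, $A^+=(A')^*[p_1|\square B_1^+,\dots,p_n|\square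 B_n^+]$. *The relation $\blacktriangleright^*$* is the smallest relation on modal propositions such that: - A1: if $i\mathsf{K4}\vdash A\to B$ then $A\blacktriangleright^*B$; - A2: if $A\blacktriangleright^*B$ and $B\blacktriangleright^*C$ then $A\blacktriangleright^*C$; - A3: if $C\blacktriangleright^*A$ and $C\blacktriangleright^*B$ then $C\blacktriangleright^*A\wedge B$; - A4: if $A\blacktriangleright^*B$ then $\square A\blacktriangleright^*\square B$; - B1: if $A\blacktriangleright^*C$ and $B\blacktriangleright^*C$ then $A\vee B\blacktriangleright^*C$; - B2: if $X$ is a finite set of implications, $B=\bigwedge X$ and $Z=\{E: E\to F\in X\}\cup\{C\}$, then $(B\to C)\wedge\square B\blacktriangleright^*[B]Z$; - B3: if $A\blacktriangleright^*B$ and $p$ is atomic or boxed, then $(p\to A)\blacktriangleright^*(p\to B)$. **Theorem.** For every modal proposition $A$, the TNNIL-approximation of $A^\square$ exists (the algorithm has at least one output on $A^\square$), and every output $(A^\square)^+$ of the algorithm satisfies $$A^\square\blacktriangleright^*(A^\square)^+\quad\text{and}\quad(A^\square)^+\blacktriangleright^*A^\square .$$ -/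

import Mathlib

/-- Formulas of propositional modal logic over the atomic variables `α`; a formula without
`box` is a non-modal formula. -/
inductive Form (α : Type*) : Type _
  | atom : α → Form α
  | bot : Form α
  | top : Form α
  | and : Form α → Form α → Form α
  | or : Form α → Form α → Form α
  | imp : Form α → Form α → Form α
  | box : Form α → Form α

namespace Form

variable {α β : Type*}

/-! ### The logics and the box translation -/

/-- Intuitionistic propositional logic in the modal language (no axiom for `box`). -/
inductive IPC : Form α → Prop
  | k (A B : Form α) : IPC (A.imp (B.imp A))
  | s (A B C : Form α) :
      IPC ((A.imp (B.imp C)).imp ((A.imp B).imp (A.imp C)))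
  | andLeft (A B : Form α) : IPC ((A.and B).imp A)
  | andRight (A B : Form α) : IPC ((A.and B).imp B)
  | andIntro (A B : Form α) : IPC (A.imp (B.imp (A.and B)))
  | orLeft (A B : Form α) : IPC (A.imp (A.or B))
  | orRight (A B : Form α) : IPC (B.imp (A.or B))
  | orElim (A B C : Form α) :
      IPC ((A.imp C).imp ((B.imp C).imp ((A.or B).imp C)))
  | botElim (A : Form α) : IPC (bot.imp A)
  | topIntro : IPC (top : Form α)
  | mp {A B : Form α} : IPC (A.imp B) → IPC A → IPC B

/-- The intuitionistic modal logic iK4. -/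
inductive IK4 : Form α → Prop
  | ipc {A : Form α} : IPC A → IK4 A
  | distrib (A B : Form α) : IK4 ((A.imp B).box.imp (A.box.imp B.box))
  | four (A : Form α) : IK4 (A.box.imp A.box.box)
  | nec {A : Form α} : IK4 A → IK4 A.box
  | mp {A B : Form α} : IK4 (A.imp B) → IK4 A → IK4 B

/-- The box translation. -/
def boxTrans : Form α → Form α
  | atom a => (atom a).and (atom a).box
  | bot => bot
  | top => top
  | and A B => A.boxTrans.and B.boxTrans
  | or A B => A.boxTrans.or B.boxTrans
  | imp A B => (A.boxTrans.imp B.boxTrans).and (A.boxTrans.imp B.boxTrans).box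
  | box A => A.boxTrans.box

/-! ### Finite conjunctions and disjunctions -/

def listConj : List (Form α) → Form α
  | [] => top
  | [A] => A
  | A :: B :: l => A.and (listConj (B :: l))

def listDisj : List (Form α) → Form α
  | [] => bot
  | [A] => A
  | A :: B :: l => A.or (listDisj (B :: l))

/-- The conjunction `⋀ X` of a finite set, written in some fixed order. -/
noncomputable def conj (X : Finset (Form α)) : Form α := listConj X.toList

/-- The disjunction `⋁ X` of a finite set, written in some fixed order. -/
noncomputable def disj (X : Finset (Form α)) : Form α := listDisj X.toList

open Classical in
/-- `IsConj X B`: the formula `B` is a conjunction of the finite set `X`, in any order and with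
any bracketing and repetitions; `top` is the empty conjunction. -/
inductive IsConj : Finset (Form α) → Form α → Prop
  | empty : IsConj ∅ top
  | single (A : Form α) : IsConj {A} A
  | and {X Y : Finset (Form α)} {A B : Form α} :
      IsConj X A → IsConj Y B → IsConj (X ∪ Y) (A.and B)

open Classical in
/-- `IsDisj Y C`: the formula `C` is a disjunction of the finite set `Y`, in any order and with
any bracketing and repetitions; `bot` is the empty disjunction. -/
inductive IsDisj : Finset (Form α) → Form α → Prop
  | empty : IsDisj ∅ bot
  | single (A : Form α) : IsDisj {A} A
  | or {X Y : Finset (Form α)} {A B : Form α} :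
      IsDisj X A → IsDisj Y B → IsDisj (X ∪ Y) (A.or B)

/-! ### The brackets -/

open Classical in
/-- `A.replace E F` is `A` with each occurrence of `E` replaced by `F`. -/
noncomputable def replace (E F : Form α) (A : Form α) : Form α :=
  if A = E then F else
    match A with
    | atom a => atom a
    | bot => bot
    | top => top
    | and A B => (replace E F A).and (replace E F B)
    | or A B => (replace E F A).or (replace E F B)
    | imp A B => (replace E F A).imp (replace E F B)
    | box A => (replace E F A).box

/-- `bracket A B` is `[A]B`. -/
def bracket (A : Form α) : Form α → Form α
  | atom a => atom a
  | bot => bot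
  | top => top
  | and B₁ B₂ => (bracket A B₁).and (bracket A B₂)
  | or B₁ B₂ => (bracket A B₁).or (bracket A B₂)
  | imp B₁ B₂ => A.imp (B₁.imp B₂)
  | box B => B.box

/-- `bracket' A B` is `[A]'B`. -/
noncomputable def bracket' (A : Form α) : Form α → Form α
  | atom a => atom a
  | bot => bot
  | top => top
  | and B₁ B₂ => (bracket' A B₁).and (bracket' A B₂)
  | or B₁ B₂ => (bracket' A B₁).or (bracket' A B₂)
  | imp B₁ B₂ => ((replace (B₁.imp B₂) B₂ A).and B₁).imp B₂
  | box B => B.box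

/-! A finite set of implications is given as a finite set `X` of pairs `(E, F)`,
where `(E, F)` stands for `E → F`. -/

/-- The implication `E → F` that a pair `(E, F)` stands for. -/
def toImp (D : Form α × Form α) : Form α := D.1.imp D.2

open Classical in
/-- The set of formulas `{E → F | (E, F) ∈ X}`. -/
noncomputable def imps (X : Finset (Form α × Form α)) : Finset (Form α) := X.image toImp

open Classical in
/-- `Z = {E | E → F ∈ X} ∪ {C}`. -/
noncomputable def zSet (X : Finset (Form α × Form α)) (C : Form α) : Finset (Form α) :=
  X.image Prod.fst ∪ {C}

open Classical in
/-- `[B]Z = ⋁ {[B]E | E ∈ Z}`. -/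
noncomputable def bracketSet (B : Form α) (Z : Finset (Form α)) : Form α :=
  disj (Z.image (bracket B))

open Classical in
/-- `[B]'Z = ⋁ {[B]'E | E ∈ Z}`. -/
noncomputable def bracketSet' (B : Form α) (Z : Finset (Form α)) : Form α :=
  disj (Z.image (bracket' B))

open Classical in
/-- `B ↓ D = ⋀ ((X \ {D}) ∪ {F})` for `B = ⋀ X` and `D = (E → F) ∈ X`. -/
noncomputable def down (X : Finset (Form α × Form α)) (D : Form α × Form α) : Form α :=
  conj ((imps X \ {toImp D}) ∪ {D.2})

/-! ### The complexity measure -/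

open Classical in
/-- The set of subformulas that are implications and occur outside the scope of every box. -/
noncomputable def outerImps : Form α → Finset (Form α)
  | atom _ => ∅
  | bot => ∅
  | top => ∅
  | and A B => outerImps A ∪ outerImps B
  | or A B => outerImps A ∪ outerImps B
  | imp A B => {A.imp B} ∪ outerImps A ∪ outerImps B
  | box _ => ∅

/-- `max {|I(E)| : E ∈ I(D)}`, where `I` is `outerImps` (and `max ∅ = 0`). -/
noncomputable def iMeasure (D : Form α) : ℕ :=
  (outerImps D).sup fun E => (outerImps E).card

/-- The number of occurrences of connectives outside the scope of a box; a boxed formula is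
treated as an atom. -/
def cMeasure : Form α → ℕ
  | atom _ => 0
  | bot => 0
  | top => 0
  | and A B => cMeasure A + cMeasure B + 1
  | or A B => cMeasure A + cMeasure B + 1
  | imp A B => cMeasure A + cMeasure B + 1
  | box _ => 0

/-- The maximal number of nested boxes. -/
def dMeasure : Form α → ℕ
  | atom _ => 0
  | bot => 0
  | top => 0
  | and A B => max (dMeasure A) (dMeasure B)
  | or A B => max (dMeasure A) (dMeasure B)
  | imp A B => max (dMeasure A) (dMeasure B)
  | box A => dMeasure A + 1

/-- The lexicographic order on the triples `(d, i, c)`. -/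
def MeasureLT (A B : Form α) : Prop :=
  dMeasure A < dMeasure B ∨
    (dMeasure A = dMeasure B ∧
      (iMeasure A < iMeasure B ∨ (iMeasure A = iMeasure B ∧ cMeasure A < cMeasure B)))

/-! ### The NNIL-algorithm -/

/-- A formula `J(q)` in which the variable `q` occurs exactly once, and outside the scope of
implications and boxes. -/
inductive OuterCtx (α : Type*) : Type _
  | hole : OuterCtx α
  | andL : OuterCtx α → Form α → OuterCtx α
  | andR : Form α → OuterCtx α → OuterCtx α
  | orL : OuterCtx α → Form α → OuterCtx α
  | orR : Form α → OuterCtx α → OuterCtx α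

/-- `J.fill E` is `J[q | E]`. -/
def OuterCtx.fill : OuterCtx α → Form α → Form α
  | hole, E => E
  | andL J A, E => (J.fill E).and A
  | andR A J, E => A.and (J.fill E)
  | orL J A, E => (J.fill E).or A
  | orR A J, E => A.or (J.fill E)

/-- Atomic variables and boxed formulas. -/
def IsAtomOrBox : Form α → Prop
  | atom _ => True
  | box _ => True
  | _ => False

/-- Atoms (including `top`, `bot`), boxed formulas and implications. -/
def IsSimple : Form α → Prop
  | and _ _ => False
  | or _ _ => False
  | _ => True

open Classical in
/-- `NNILOut A P`: the (non-deterministic) NNIL-algorithm, started on `A`, can return `P`;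
that is, `P` is a possible value of `A*`. -/
inductive NNILOut : Form α → Form α → Prop
  | atomOrBox {A : Form α} : A.IsAtomOrBox → NNILOut A A
  | bot : NNILOut bot bot
  | top : NNILOut top top
  | and {B C B' C' : Form α} :
      NNILOut B B' → NNILOut C C' → NNILOut (B.and C) (B'.and C')
  | or {B C B' C' : Form α} :
      NNILOut B B' → NNILOut C C' → NNILOut (B.or C) (B'.or C')
  /-- `B → C`, where `C` has an outer occurrence of a conjunction `D ∧ E`. -/
  | impAnd {B D E P₁ P₂ : Form α} (J : OuterCtx α) :
      NNILOut (B.imp (J.fill D)) P₁ → NNILOut (B.imp (J.fill E)) P₂ →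
      NNILOut (B.imp (J.fill (D.and E))) (P₁.and P₂)
  /-- `B → C`, where `B` has an outer occurrence of a disjunction `D ∨ E`. -/
  | orImp {C D E P₁ P₂ : Form α} (J : OuterCtx α) :
      NNILOut ((J.fill D).imp C) P₁ → NNILOut ((J.fill E).imp C) P₂ →
      NNILOut ((J.fill (D.or E)).imp C) (P₁.and P₂)
  /-- `⋀ X → ⋁ Y`, where `X` contains an atomic or boxed formula `p`. -/
  | impAtom {X Y : Finset (Form α)} {B C p P : Form α} :
      IsConj X B → (∀ E ∈ X, E.IsSimple) → IsDisj Y C → (∀ E ∈ Y, E.IsSimple) →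
      p ∈ X → p.IsAtomOrBox →
      NNILOut ((conj (X \ {p})).imp C) P →
      NNILOut (B.imp C) (p.imp P)
  /-- `⋀ X → ⋁ Y`, where `X` contains `⊤`. -/
  | impTop {X Y : Finset (Form α)} {B C P : Form α} :
      IsConj X B → (∀ E ∈ X, E.IsSimple) → IsDisj Y C → (∀ E ∈ Y, E.IsSimple) →
      Form.top ∈ X →
      NNILOut ((conj (X \ {Form.top})).imp C) P →
      NNILOut (B.imp C) P
  /-- `⋀ X → ⋁ Y`, where `X` contains `⊥`. -/
  | impBot {X Y : Finset (Form α)} {B C : Form α} :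
      IsConj X B → (∀ E ∈ X, E.IsSimple) → IsDisj Y C → (∀ E ∈ Y, E.IsSimple) →
      Form.bot ∈ X →
      NNILOut (B.imp C) Form.top
  /-- `⋀ X → ⋁ Y`, where `X` contains only implications, and `[B]Z` is simpler. -/
  | impImps {X : Finset (Form α × Form α)} {Y : Finset (Form α)} {B C P : Form α}
      (g : Form α × Form α → Form α) :
      IsConj (imps X) B → IsDisj Y C → (∀ E ∈ Y, E.IsSimple) →
      MeasureLT (bracketSet B (zSet X C)) (B.imp C) →
      (∀ D ∈ X, NNILOut ((down X D).imp C) (g D)) →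
      NNILOut (bracketSet B (zSet X C)) P →
      NNILOut (B.imp C) ((conj (X.image g)).and P)
  /-- `⋀ X → ⋁ Y`, where `X` contains only implications, and `[B]Z` is not simpler. -/
  | impImps' {X : Finset (Form α × Form α)} {Y : Finset (Form α)} {B C P : Form α}
      (g : Form α × Form α → Form α) :
      IsConj (imps X) B → IsDisj Y C → (∀ E ∈ Y, E.IsSimple) →
      ¬ MeasureLT (bracketSet B (zSet X C)) (B.imp C) →
      (∀ D ∈ X, NNILOut ((down X D).imp C) (g D)) →
      NNILOut (bracketSet' B (zSet X C)) P →
      NNILOut (B.imp C) ((conj (X.image g)).and P)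

/-! ### The TNNIL-algorithm -/

/-- The non-modal formula `A'` obtained from `A` by putting a fresh variable for each outermost
boxed subformula: `Sum.inr B` is the fresh variable for `box B`. -/
def skeleton : Form α → Form (α ⊕ Form α)
  | atom a => atom (Sum.inl a)
  | bot => bot
  | top => top
  | and A B => A.skeleton.and B.skeleton
  | or A B => A.skeleton.or B.skeleton
  | imp A B => A.skeleton.imp B.skeleton
  | box B => atom (Sum.inr B)

/-- The formulas `B` such that `box B` is an outermost boxed subformula. -/
def outerBoxes : Form α → Set (Form α)
  | atom _ => ∅
  | bot => ∅
  | top => ∅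
  | and A B => outerBoxes A ∪ outerBoxes B
  | or A B => outerBoxes A ∪ outerBoxes B
  | imp A B => outerBoxes A ∪ outerBoxes B
  | box B => {B}

/-- Simultaneous substitution of formulas for the atomic variables. -/
def subst (σ : α → Form β) : Form α → Form β
  | atom a => σ a
  | bot => bot
  | top => top
  | and A B => (A.subst σ).and (B.subst σ)
  | or A B => (A.subst σ).or (B.subst σ)
  | imp A B => (A.subst σ).imp (B.subst σ)
  | box A => (A.subst σ).box

/-- `TNNILOut A P`: the (non-deterministic) TNNIL-algorithm, started on `A`, can return `P`;
that is, `P` is a possible value of `A⁺ = (A')*[p₁ | □B₁⁺, …, pₙ | □Bₙ⁺]`, where `f B` is the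
value of `B⁺` that is used. -/
inductive TNNILOut : Form α → Form α → Prop
  | mk {A : Form α} {Q : Form (α ⊕ Form α)} (f : Form α → Form α) :
      NNILOut A.skeleton Q →
      (∀ B ∈ outerBoxes A, TNNILOut B (f B)) →
      TNNILOut A (Q.subst (Sum.elim atom fun B => (f B).box))

/-! ### The relation `▸*` -/

/-- The relation `A ▸* B`. -/
inductive Pres : Form α → Form α → Prop
  | A1 {A B : Form α} : IK4 (A.imp B) → Pres A B
  | A2 {A B C : Form α} : Pres A B → Pres B C → Pres A C
  | A3 {A B C : Form α} : Pres C A → Pres C B → Pres C (A.and B)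
  | A4 {A B : Form α} : Pres A B → Pres A.box B.box
  | B1 {A B C : Form α} : Pres A C → Pres B C → Pres (A.or B) C
  | B2 {X : Finset (Form α × Form α)} {B C : Form α} : IsConj (imps X) B →
      Pres ((B.imp C).and B.box) (bracketSet B (zSet X C))
  | B3 {A B p : Form α} : p.IsAtomOrBox → Pres A B → Pres (p.imp A) (p.imp B)

/-- `A ▸◂* B`. -/
def PresEquiv (A B : Form α) : Prop := Pres A B ∧ Pres B A

end Form

namespace Form

open scoped Classical

variable {α β : Type*}

/-! ### Derivability from local hypotheses -/

/-! The algorithm acts on the skeleton of a formula, where each outermost boxed formula is a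
variable. Everything is therefore proved for box-free formulas, with derivability taken after the
substitution `s` that puts the boxed formulas back.

One direction needs no special form of the input: every output of the NNIL-algorithm implies its
input already by intuitionistic reasoning (`NNILOut.entails`).

For the converse, the only critical step is the one on `B → C` with `B` a conjunction of
implications. Rule B2 yields `[B]Z`, which implies `[B]'Z`, but only from `(B → C) ∧ □B`. So `□B`
must come for free. In a box translation each atom stands beside its own box, and so does each
implication, apart from a bare implication directly under a box. Hence, if an antecedent is split
into the cases of its disjunctive normal form, each case proves its own boxing from the variables
occurring in it. The algorithm moves these variables out of the antecedent as premises `p → ...`.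
Once only implications remain, all the needed variables are in the accumulated context `σ`, and `σ`
proves `□B` (`Stable.box_of_imps`).

The invariant `Stable` expresses this hereditarily. For an implication `E → F` in a case of an
antecedent, `E` may become a disjunct of `[B]Z`, hence positive, while `F` may become a conjunct of
`B ↓ D`, hence part of an antecedent. The invariant must survive every step of the algorithm. The
delicate one is `[B]'`, which replaces `E → F` by `F` next to the new conjunct `E`
(`Stable.replace`, `Stable.bracket'`). Preservativity is carried along relative to the context `σ`,
which rule B3 permits since `σ` consists of atomic or boxed formulas (`NNILOut.ctxPres`).

The recursion under boxes uses that `□B ▸ □B'` gives `⊤ ▸ (□B → □B')` by B3. The formulas preserved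
from `⊤` are closed under `iK4` consequence, so boxed formulas may be exchanged in any position
(`PresEquiv.subst_box`).

Existence of outputs is termination: box-free formulas have `dMeasure` zero, and when `[B]Z` is not
simpler, `[B]'Z` strictly lowers `iMeasure` (`iMeasure_bracketSet'_lt`). -/

/-- Derivability in `iK4` from local hypotheses, after the substitution `s`. -/
inductive Entails (s : β → Form α) (Γ : Set (Form β)) : Form β → Prop
  | thm {A : Form β} : IK4 (A.subst s) → Entails s Γ A
  | hyp {A : Form β} : A ∈ Γ → Entails s Γ A
  | mp {A B : Form β} : Entails s Γ (A.imp B) → Entails s Γ A → Entails s Γ B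

namespace Entails

variable {s : β → Form α} {Γ Δ : Set (Form β)} {A B C : Form β}

theorem cut (h : Entails s Γ A) (hΓ : ∀ x ∈ Γ, Entails s Δ x) : Entails s Δ A := by
  induction h with
  | thm h => exact .thm h
  | hyp h => exact hΓ _ h
  | mp _ _ h₁ h₂ => exact .mp h₁ h₂

theorem mono (h : Entails s Γ A) (hΓ : Γ ⊆ Δ) : Entails s Δ A :=
  h.cut fun _ hx => .hyp (hΓ hx)

theorem weaken (h : Entails s Γ A) : Entails s (insert B Γ) A := h.mono (Set.subset_insert _ _)

theorem head : Entails s (insert A Γ) A := .hyp (Set.mem_insert _ _)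

theorem single : Entails s {A} A := .hyp rfl

theorem ipc (h : IPC (A.subst s)) : Entails s Γ A := .thm (.ipc h)

theorem const (h : Entails s Γ B) : Entails s Γ (A.imp B) := .mp (.ipc (.k _ _)) h

theorem imp_distrib (h : Entails s Γ (A.imp (B.imp C))) (h' : Entails s Γ (A.imp B)) :
    Entails s Γ (A.imp C) :=
  .mp (.mp (.ipc (.s (A.subst s) (B.subst s) (C.subst s)) :
    Entails s Γ ((A.imp (B.imp C)).imp ((A.imp B).imp (A.imp C)))) h) h'

theorem imp_self : Entails s Γ (A.imp A) :=
  imp_distrib (B := A.imp A) (.ipc (.k _ _)) (.ipc (.k _ _))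

theorem imp_intro (h : Entails s (insert A Γ) B) : Entails s Γ (A.imp B) := by
  induction h with
  | thm h => exact const (.thm h)
  | hyp h =>
    rcases h with rfl | h
    · exact imp_self
    · exact const (.hyp h)
  | mp _ _ h₁ h₂ => exact imp_distrib h₁ h₂

theorem imp_elim (h : Entails s Γ (A.imp B)) : Entails s (insert A Γ) B := h.weaken.mp head

theorem and_intro (h₁ : Entails s Γ A) (h₂ : Entails s Γ B) : Entails s Γ (A.and B) :=
  .mp (.mp (.ipc (.andIntro _ _)) h₁) h₂

theorem left (h : Entails s Γ (A.and B)) : Entails s Γ A :=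
  .mp (.ipc (.andLeft (A.subst s) (B.subst s)) :
    Entails s Γ ((A.and B).imp A)) h

theorem right (h : Entails s Γ (A.and B)) : Entails s Γ B :=
  .mp (.ipc (.andRight (A.subst s) (B.subst s)) :
    Entails s Γ ((A.and B).imp B)) h

theorem inl (h : Entails s Γ A) : Entails s Γ (A.or B) := .mp (.ipc (.orLeft _ _)) h

theorem inr (h : Entails s Γ B) : Entails s Γ (A.or B) := .mp (.ipc (.orRight _ _)) h

theorem or_elim (h : Entails s Γ (A.or B)) (h₁ : Entails s (insert A Γ) C)
    (h₂ : Entails s (insert B Γ) C) : Entails s Γ C :=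
  .mp (.mp (.mp (.ipc (.orElim (A.subst s) (B.subst s) (C.subst s)) :
    Entails s Γ ((A.imp C).imp ((B.imp C).imp ((A.or B).imp C)))) h₁.imp_intro) h₂.imp_intro) h

theorem bot_elim (h : Entails s Γ bot) : Entails s Γ A :=
  .mp (.ipc (.botElim (A.subst s)) :
    Entails s Γ (bot.imp A)) h

theorem top : Entails s Γ top := .ipc .topIntro

theorem box_mp (h : Entails s Γ (A.imp B).box) (h' : Entails s Γ A.box) : Entails s Γ B.box :=
  .mp (.mp (.thm (.distrib (A.subst s) (B.subst s)) :
    Entails s Γ ((A.imp B).box.imp (A.box.imp B.box))) h) h'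

/-- If the boxed hypotheses of a derivation are derivable, so is its boxed conclusion. -/
theorem box_cut (h : Entails s Γ A) (hΓ : ∀ x ∈ Γ, Entails s Δ x.box) : Entails s Δ A.box := by
  induction h with
  | thm h => exact .thm (.nec h)
  | hyp h => exact hΓ _ h
  | mp _ _ h₁ h₂ => exact box_mp h₁ h₂

theorem ik4 (h : Entails s ∅ A) : IK4 (A.subst s) := by
  induction h with
  | thm h => exact h
  | hyp h => exact h.elim
  | mp _ _ h₁ h₂ => exact .mp h₁ h₂

theorem ik4_imp (h : Entails s {A} B) : IK4 ((A.subst s).imp (B.subst s)) :=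
  (imp_intro (A := A) (Γ := ∅) (by simpa using h)).ik4

theorem listConj_intro : ∀ {l : List (Form β)}, (∀ x ∈ l, Entails s Γ x) →
    Entails s Γ (listConj l)
  | [], _ => top
  | [A], h => h A (by simp)
  | _ :: _ :: _, h => and_intro (h _ (by simp)) (listConj_intro fun x hx => h x (by simp_all))

theorem conj_intro {X : Finset (Form β)} (h : ∀ x ∈ X, Entails s Γ x) : Entails s Γ (conj X) :=
  listConj_intro (by simpa using h)

theorem listConj_elim {x : Form β} : ∀ {l : List (Form β)}, Entails s Γ (listConj l) → x ∈ l →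
    Entails s Γ x
  | [_], h, hx => by simp_all [listConj]
  | _ :: _ :: _, h, hx => by
    rcases List.mem_cons.1 hx with rfl | hx
    · exact h.left
    · exact listConj_elim h.right hx

theorem conj_elim {X : Finset (Form β)} {x : Form β} (h : Entails s Γ (conj X)) (hx : x ∈ X) :
    Entails s Γ x :=
  listConj_elim h (by simpa using hx)

theorem listDisj_intro {x : Form β} : ∀ {l : List (Form β)}, Entails s Γ x → x ∈ l →
    Entails s Γ (listDisj l)
  | [_], h, hx => by simp_all [listDisj]
  | _ :: _ :: _, h, hx => by
    rcases List.mem_cons.1 hx with rfl | hx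
    · exact h.inl
    · exact (listDisj_intro h hx).inr

theorem disj_intro {X : Finset (Form β)} {x : Form β} (h : Entails s Γ x) (hx : x ∈ X) :
    Entails s Γ (disj X) :=
  listDisj_intro h (by simpa using hx)

theorem listDisj_elim : ∀ {l : List (Form β)} {Γ : Set (Form β)}, Entails s Γ (listDisj l) →
    (∀ x ∈ l, Entails s (insert x Γ) C) → Entails s Γ C
  | [], _, h, _ => h.bot_elim
  | [A], _, h, hl => (hl A (by simp)).imp_intro.mp h
  | _ :: _ :: _, _, h, hl => by
    refine h.or_elim (hl _ (by simp)) (listDisj_elim head fun x hx => ?_)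
    exact (hl x (by simp_all)).mono (Set.insert_subset_insert (Set.subset_insert _ _))

theorem disj_elim {X : Finset (Form β)} (h : Entails s Γ (disj X))
    (hX : ∀ x ∈ X, Entails s (insert x Γ) C) : Entails s Γ C :=
  listDisj_elim h (by simpa using hX)

theorem isConj_iff {X : Finset (Form β)} (h : IsConj X B) :
    Entails s Γ B ↔ ∀ x ∈ X, Entails s Γ x := by
  induction h with
  | empty => simp [top]
  | single A => simp
  | and _ _ h₁ h₂ =>
    constructor
    · intro h x hx
      rcases Finset.mem_union.1 hx with hx | hx
      · exact h₁.1 h.left x hx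
      · exact h₂.1 h.right x hx
    · exact fun h => and_intro (h₁.2 fun x hx => h x (Finset.mem_union_left _ hx))
        (h₂.2 fun x hx => h x (Finset.mem_union_right _ hx))

end Entails

/-! ### Outer contexts -/

section Fill

variable {s : β → Form α} {Γ : Set (Form β)} {D E : Form β}

theorem Entails.fill_mono {J : OuterCtx β} : ∀ {Γ : Set (Form β)}, Entails s Γ (D.imp E) →
    Entails s Γ (J.fill D) → Entails s Γ (J.fill E) := by
  induction J with
  | hole => exact fun h h' => h.mp h'
  | andL J A ih => exact fun h h' => (ih h h'.left).and_intro h'.right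
  | andR A J ih => exact fun h h' => h'.left.and_intro (ih h h'.right)
  | orL J A ih => exact fun h h' => h'.or_elim (ih h.weaken .head).inl Entails.head.inr
  | orR A J ih => exact fun h h' => h'.or_elim Entails.head.inl (ih h.weaken .head).inr

/-- Only conjunctions and disjunctions lie above the hole. At a disjunction, if either hypothesis
chooses the branch without the hole, that branch already proves the goal. -/
theorem Entails.fill_and {J : OuterCtx β} : ∀ {Γ : Set (Form β)}, Entails s Γ (J.fill D) →
    Entails s Γ (J.fill E) → Entails s Γ (J.fill (D.and E)) := by
  induction J with
  | hole => exact fun h h' => h.and_intro h'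
  | andL J A ih => exact fun h h' => (ih h.left h'.left).and_intro h'.right
  | andR A J ih => exact fun h h' => h'.left.and_intro (ih h.right h'.right)
  | orL J A ih =>
    exact fun h h' => h.or_elim (h'.weaken.or_elim (ih Entails.head.weaken .head).inl
      Entails.head.inr) Entails.head.inr
  | orR A J ih =>
    exact fun h h' => h.or_elim Entails.head.inl (h'.weaken.or_elim Entails.head.inl
      (ih Entails.head.weaken .head).inr)

theorem Entails.fill_or {J : OuterCtx β} : ∀ {Γ : Set (Form β)},
    Entails s Γ (J.fill (D.or E)) → Entails s Γ ((J.fill D).or (J.fill E)) := by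
  induction J with
  | hole => exact fun h => h
  | andL J A ih =>
    exact fun h => (ih h.left).or_elim (Entails.head.and_intro h.right.weaken).inl
      (Entails.head.and_intro h.right.weaken).inr
  | andR A J ih =>
    exact fun h => (ih h.right).or_elim (h.left.weaken.and_intro Entails.head).inl
      (h.left.weaken.and_intro Entails.head).inr
  | orL J A ih =>
    exact fun h => h.or_elim ((ih Entails.head).or_elim Entails.head.inl.inl
      Entails.head.inl.inr) Entails.head.inr.inl
  | orR A J ih =>
    exact fun h => h.or_elim Entails.head.inl.inl ((ih Entails.head).or_elim
      Entails.head.inr.inl Entails.head.inr.inr)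

end Fill

/-! ### Formulas without boxes over a set of variables -/

/-- The formula contains no box and its variables lie in `S`. -/
def Over (S : Set β) : Form β → Prop
  | atom a => a ∈ S
  | bot => True
  | top => True
  | and A B => Over S A ∧ Over S B
  | or A B => Over S A ∧ Over S B
  | imp A B => Over S A ∧ Over S B
  | box _ => False

section Over

variable {S : Set β} {A B C D E F : Form β}

theorem Over.dMeasure_eq (h : Over S A) : dMeasure A = 0 := by
  induction A with
  | atom | bot | top => rfl
  | and A B hA hB => simp [dMeasure, hA h.1, hB h.2]
  | or A B hA hB => simp [dMeasure, hA h.1, hB h.2]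
  | imp A B hA hB => simp [dMeasure, hA h.1, hB h.2]
  | box => exact h.elim

theorem over_fill_congr {J : OuterCtx β} (h : Over S (J.fill D)) (h' : Over S D → Over S E) :
    Over S (J.fill E) := by
  induction J with
  | hole => exact h' h
  | andL J A ih => exact ⟨ih h.1, h.2⟩
  | andR A J ih => exact ⟨h.1, ih h.2⟩
  | orL J A ih => exact ⟨ih h.1, h.2⟩
  | orR A J ih => exact ⟨h.1, ih h.2⟩

theorem over_listConj : ∀ {l : List (Form β)}, (∀ x ∈ l, Over S x) → Over S (listConj l)
  | [], _ => trivial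
  | [A], h => h A (by simp)
  | _ :: _ :: _, h => ⟨h _ (by simp), over_listConj fun x hx => h x (by simp_all)⟩

theorem over_listDisj : ∀ {l : List (Form β)}, (∀ x ∈ l, Over S x) → Over S (listDisj l)
  | [], _ => trivial
  | [A], h => h A (by simp)
  | _ :: _ :: _, h => ⟨h _ (by simp), over_listDisj fun x hx => h x (by simp_all)⟩

theorem over_conj {X : Finset (Form β)} (h : ∀ x ∈ X, Over S x) : Over S (conj X) :=
  over_listConj (by simpa using h)

theorem over_disj {X : Finset (Form β)} (h : ∀ x ∈ X, Over S x) : Over S (disj X) :=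
  over_listDisj (by simpa using h)

theorem IsConj.over {X : Finset (Form β)} (h : IsConj X B) (hB : Over S B) :
    ∀ x ∈ X, Over S x := by
  induction h with
  | empty => simp
  | single A => simpa using hB
  | and _ _ h₁ h₂ =>
    intro x hx
    rcases Finset.mem_union.1 hx with hx | hx
    exacts [h₁ hB.1 x hx, h₂ hB.2 x hx]

theorem over_bracket (hB : Over S B) (hE : Over S E) : Over S (bracket B E) := by
  induction E with
  | atom | bot | top => exact hE
  | and _ _ h₁ h₂ => exact ⟨h₁ hE.1, h₂ hE.2⟩
  | or _ _ h₁ h₂ => exact ⟨h₁ hE.1, h₂ hE.2⟩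
  | imp => exact ⟨hB, hE⟩
  | box => exact hE.elim

theorem over_replace (hF : Over S F) (hA : Over S A) : Over S (replace E F A) := by
  induction A with
  | atom | bot | top => unfold replace; split <;> assumption
  | and _ _ h₁ h₂ => unfold replace; split; exacts [hF, ⟨h₁ hA.1, h₂ hA.2⟩]
  | or _ _ h₁ h₂ => unfold replace; split; exacts [hF, ⟨h₁ hA.1, h₂ hA.2⟩]
  | imp _ _ h₁ h₂ => unfold replace; split; exacts [hF, ⟨h₁ hA.1, h₂ hA.2⟩]
  | box => exact hA.elim

theorem over_bracket' (hB : Over S B) (hE : Over S E) : Over S (bracket' B E) := by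
  induction E with
  | atom | bot | top => exact hE
  | and _ _ h₁ h₂ => exact ⟨h₁ hE.1, h₂ hE.2⟩
  | or _ _ h₁ h₂ => exact ⟨h₁ hE.1, h₂ hE.2⟩
  | imp => exact ⟨⟨over_replace hE.2 hB, hE.1⟩, hE.2⟩
  | box => exact hE.elim

theorem mem_imps {X : Finset (Form β × Form β)} : E.imp F ∈ imps X ↔ (E, F) ∈ X := by
  simp [imps, toImp]

theorem exists_of_mem_imps {X : Finset (Form β × Form β)} {x : Form β} (hx : x ∈ imps X) :
    ∃ E F, x = E.imp F ∧ (E, F) ∈ X := by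
  simp only [imps, toImp, Finset.mem_image, Prod.exists] at hx
  obtain ⟨E, F, h, rfl⟩ := hx
  exact ⟨E, F, rfl, h⟩

theorem mem_zSet {X : Finset (Form β × Form β)} {x : Form β} :
    x ∈ zSet X C ↔ x = C ∨ ∃ F, (x, F) ∈ X := by
  simp [zSet]

theorem mem_down {X : Finset (Form β × Form β)} {x : Form β}
    (hx : x ∈ (imps X \ {E.imp F}) ∪ {F}) : x = F ∨ x ∈ imps X := by
  simp only [Finset.mem_union, Finset.mem_sdiff, Finset.mem_singleton] at hx
  tauto

variable {X : Finset (Form β × Form β)}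

theorem over_zSet (hX : IsConj (imps X) B) (hB : Over S B) (hC : Over S C) :
    ∀ x ∈ zSet X C, Over S x := by
  intro x hx
  obtain rfl | ⟨F, h⟩ := mem_zSet.1 hx
  · exact hC
  · exact (hX.over hB _ (mem_imps.2 h)).1

theorem over_bracketSet (hX : IsConj (imps X) B) (hB : Over S B) (hC : Over S C) :
    Over S (bracketSet B (zSet X C)) := by
  refine over_disj fun x hx => ?_
  obtain ⟨E, hE, rfl⟩ := Finset.mem_image.1 hx
  exact over_bracket hB (over_zSet hX hB hC E hE)

theorem over_bracketSet' (hX : IsConj (imps X) B) (hB : Over S B) (hC : Over S C) :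
    Over S (bracketSet' B (zSet X C)) := by
  refine over_disj fun x hx => ?_
  obtain ⟨E, hE, rfl⟩ := Finset.mem_image.1 hx
  exact over_bracket' hB (over_zSet hX hB hC E hE)

theorem over_down (hX : IsConj (imps X) B) (hB : Over S B) {D : Form β × Form β} (hD : D ∈ X) :
    Over S (down X D) := by
  refine over_conj fun x hx => ?_
  obtain rfl | hx := mem_down hx
  · exact (hX.over hB _ (mem_imps.2 hD)).2
  · exact hX.over hB x hx

end Over

/-! ### Replacement and brackets -/

section Bracket

variable {s : β → Form α} {Γ : Set (Form β)} {A B C D E F : Form β}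

theorem replace_eq (D E A : Form β) : replace D E A = if A = D then E else
    match A with
    | atom a => atom a
    | bot => bot
    | top => top
    | and A B => (replace D E A).and (replace D E B)
    | or A B => (replace D E A).or (replace D E B)
    | imp A B => (replace D E A).imp (replace D E B)
    | box A => (replace D E A).box := by
  cases A <;> rw [replace]

@[simp] theorem replace_self : replace D E D = E := by rw [replace_eq]; simp

@[simp] theorem replace_atom (a : β) : replace (E.imp F) C (atom a) = atom a := by
  rw [replace_eq]; simp

@[simp] theorem replace_bot : replace (E.imp F) C bot = bot := by rw [replace_eq]; simp

@[simp] theorem replace_top : replace (E.imp F) C top = top := by rw [replace_eq]; simp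

@[simp] theorem replace_and :
    replace (E.imp F) C (A.and B) = (replace (E.imp F) C A).and (replace (E.imp F) C B) := by
  rw [replace_eq]; simp

@[simp] theorem replace_or :
    replace (E.imp F) C (A.or B) = (replace (E.imp F) C A).or (replace (E.imp F) C B) := by
  rw [replace_eq]; simp

theorem replace_imp_of_ne (h : A.imp B ≠ D) :
    replace D C (A.imp B) = (replace D C A).imp (replace D C B) := by
  rw [replace_eq]; simp [h]

/-- Given `E`, the formulas `E → F` and `F` are equivalent, and intuitionistic connectives respect
this. Boxes are excluded because `E` is only a local hypothesis and need not hold under a box. -/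
theorem Entails.replace_iff {S : Set β} (hA : Over S A) : ∀ {Γ : Set (Form β)},
    Entails s Γ E → (Entails s Γ (replace (E.imp F) F A) ↔ Entails s Γ A) := by
  induction A with
  | atom | bot | top => simp
  | and A B h₁ h₂ =>
    intro Γ h
    rw [replace_and]
    exact ⟨fun h' => ((h₁ hA.1 h).1 h'.left).and_intro ((h₂ hA.2 h).1 h'.right),
      fun h' => ((h₁ hA.1 h).2 h'.left).and_intro ((h₂ hA.2 h).2 h'.right)⟩
  | or A B h₁ h₂ =>
    intro Γ h
    rw [replace_or]
    exact ⟨fun h' => h'.or_elim ((h₁ hA.1 h.weaken).1 .head).inl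
        ((h₂ hA.2 h.weaken).1 .head).inr,
      fun h' => h'.or_elim ((h₁ hA.1 h.weaken).2 .head).inl
        ((h₂ hA.2 h.weaken).2 .head).inr⟩
  | imp A B h₁ h₂ =>
    intro Γ h
    by_cases he : A.imp B = E.imp F
    · obtain ⟨rfl, rfl⟩ := by simpa using he
      rw [replace_self]
      exact ⟨fun h' => h'.const, fun h' => h'.mp h⟩
    · rw [replace_imp_of_ne he]
      exact ⟨fun h' => .imp_intro ((h₂ hA.2 h.weaken).1
          (h'.weaken.mp ((h₁ hA.1 h.weaken).2 .head))),
        fun h' => .imp_intro ((h₂ hA.2 h.weaken).2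
          (h'.weaken.mp ((h₁ hA.1 h.weaken).1 .head)))⟩
  | box => exact hA.elim

theorem Entails.of_bracket : ∀ {Γ : Set (Form β)}, Entails s Γ B → Entails s Γ (bracket B E) →
    Entails s Γ E := by
  induction E with
  | atom | bot | top | box => exact fun _ h => h
  | and _ _ h₁ h₂ => exact fun hB h => (h₁ hB h.left).and_intro (h₂ hB h.right)
  | or _ _ h₁ h₂ =>
    exact fun hB h => h.or_elim (h₁ hB.weaken .head).inl (h₂ hB.weaken .head).inr
  | imp => exact fun hB h => h.mp hB

theorem Entails.of_bracket' {S : Set β} (hB : Over S B) : ∀ {Γ : Set (Form β)},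
    Entails s Γ B → Entails s Γ (bracket' B E) → Entails s Γ E := by
  induction E with
  | atom | bot | top | box => exact fun _ h => h
  | and _ _ h₁ h₂ => exact fun hB h => (h₁ hB h.left).and_intro (h₂ hB h.right)
  | or _ _ h₁ h₂ =>
    exact fun hB h => h.or_elim (h₁ hB.weaken .head).inl (h₂ hB.weaken .head).inr
  | imp =>
    exact fun h h' => .imp_intro (h'.weaken.mp
      (((Entails.replace_iff hB .head).2 h.weaken).and_intro .head))

theorem Entails.bracket'_of_bracket {S : Set β} (hB : Over S B) : ∀ {Γ : Set (Form β)},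
    Entails s Γ (bracket B E) → Entails s Γ (bracket' B E) := by
  induction E with
  | atom | bot | top | box => exact fun h => h
  | and _ _ h₁ h₂ => exact fun h => (h₁ h.left).and_intro (h₂ h.right)
  | or _ _ h₁ h₂ => exact fun h => h.or_elim (h₁ .head).inl (h₂ .head).inr
  | imp =>
    exact fun h => .imp_intro ((h.weaken.mp
      ((Entails.replace_iff hB Entails.head.right).1 Entails.head.left)).mp Entails.head.right)

end Bracket

/-! ### Disjunctive cases of a formula -/

/-- The disjuncts of the disjunctive normal form of a formula, as sets of atoms, `bot`, boxed
formulas and implications. -/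
def cases : Form β → Set (Set (Form β))
  | top => {∅}
  | and A B => {c | ∃ a ∈ cases A, ∃ b ∈ cases B, c = a ∪ b}
  | or A B => cases A ∪ cases B
  | atom a => {{atom a}}
  | bot => {{bot}}
  | imp A B => {{A.imp B}}
  | box A => {{A.box}}

/-- Atomic variables and `bot`. -/
def IsLit : Form β → Prop
  | atom _ => True
  | bot => True
  | _ => False

/-- The members of `b` that are atomic variables or `bot`. -/
def lits (b : Set (Form β)) : Set (Form β) := {x ∈ b | x.IsLit}

section Cases

variable {s : β → Form α} {S : Set β} {Γ : Set (Form β)} {A B C D E F : Form β}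

theorem lits_mono {b c : Set (Form β)} (h : b ⊆ c) : lits b ⊆ lits c := fun _ hx => ⟨h hx.1, hx.2⟩

@[simp] theorem lits_imp : lits {A.imp B} = ∅ := by
  ext x
  simp only [lits, Set.mem_ofPred_eq, Set.mem_singleton_iff, Set.mem_empty_iff_false, iff_false]
  rintro ⟨rfl, h⟩
  exact h

theorem entails_of_mem_cases : ∀ {b : Set (Form β)}, b ∈ cases A → (∀ x ∈ b, Entails s Γ x) →
    Entails s Γ A := by
  induction A with
  | top => exact fun _ _ => .top
  | atom | bot | imp | box => rintro _ rfl h; exact h _ rfl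
  | and A B h₁ h₂ =>
    rintro _ ⟨a, ha, b, hb, rfl⟩ h
    exact (h₁ ha fun x hx => h x (.inl hx)).and_intro (h₂ hb fun x hx => h x (.inr hx))
  | or A B h₁ h₂ =>
    rintro b (hb | hb) h
    exacts [(h₁ hb h).inl, (h₂ hb h).inr]

theorem over_of_mem_cases (hA : Over S A) : ∀ {b : Set (Form β)}, b ∈ cases A →
    ∀ x ∈ b, Over S x := by
  induction A with
  | top => rintro _ rfl x ⟨⟩
  | atom | bot | imp | box => rintro _ rfl x rfl; exact hA
  | and A B h₁ h₂ =>
    rintro _ ⟨a, ha, b, hb, rfl⟩ x (hx | hx)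
    exacts [h₁ hA.1 ha x hx, h₂ hA.2 hb x hx]
  | or A B h₁ h₂ =>
    rintro b (hb | hb)
    exacts [h₁ hA.1 hb, h₂ hA.2 hb]

/-- Without disjunctions there is nothing to split, so there is a single case; `top` contributes the
empty set to it. -/
theorem cases_isConj {X : Finset (Form β)} (h : IsConj X B) (hX : ∀ x ∈ X, x.IsSimple) :
    cases B = {(X : Set (Form β)) \ {top}} := by
  induction h with
  | empty => simp [cases]
  | single A =>
    have hA := hX A (by simp)
    cases A with
    | and | or => exact hA.elim
    | top => simp [cases]
    | atom | bot | imp | box =>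
      simp only [cases, Finset.coe_singleton]
      rw [Set.sdiff_singleton_eq_self (by simp)]
  | and _ _ h₁ h₂ =>
    rw [cases, h₁ fun x hx => hX x (Finset.mem_union_left _ hx),
      h₂ fun x hx => hX x (Finset.mem_union_right _ hx)]
    ext c
    simp [Set.union_sdiff_distrib]

theorem isConj_listConj (l : List (Form β)) : IsConj l.toFinset (listConj l) := by
  induction l with
  | nil => exact .empty
  | cons A l ih =>
    cases l with
    | nil => exact .single A
    | cons B l =>
      rw [List.toFinset_cons, Finset.insert_eq]
      exact .and (.single A) ih

theorem isConj_conj (X : Finset (Form β)) : IsConj X (conj X) := by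
  simpa [conj] using isConj_listConj X.toList

theorem cases_fill {J : OuterCtx β} {b : Set (Form β)} (hE : ∀ b ∈ cases E, b ∈ cases D)
    (hb : b ∈ cases (J.fill E)) : b ∈ cases (J.fill D) := by
  induction J generalizing b with
  | hole => exact hE b hb
  | andL J A ih => obtain ⟨a, ha, c, hc, rfl⟩ := hb; exact ⟨a, ih ha, c, hc, rfl⟩
  | andR A J ih => obtain ⟨a, ha, c, hc, rfl⟩ := hb; exact ⟨a, ha, c, ih hc, rfl⟩
  | orL J A ih => exact hb.imp ih id
  | orR A J ih => exact hb.imp id ih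

/-- Each case of a formula with `E → F` replaced by `F` comes from a case of the formula. -/
theorem exists_case_of_replace (hA : Over S A) : ∀ {b' : Set (Form β)},
    b' ∈ cases (replace (E.imp F) F A) → ∃ b ∈ cases A, lits b ⊆ lits b' ∧
      ∀ x' ∈ b', (∃ x ∈ b, x ≠ E.imp F ∧ x' = replace (E.imp F) F x) ∨
        (E.imp F ∈ b ∧ ∃ c ∈ cases F, x' ∈ c ∧ c ⊆ b') := by
  induction A with
  | top =>
    rw [replace_top]
    rintro _ rfl
    exact ⟨∅, rfl, subset_rfl, by simp⟩
  | atom a =>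
    rw [replace_atom]
    rintro _ rfl
    exact ⟨_, rfl, subset_rfl, by rintro _ rfl; exact .inl ⟨_, rfl, by simp, by simp⟩⟩
  | bot =>
    rw [replace_bot]
    rintro _ rfl
    exact ⟨_, rfl, subset_rfl, by rintro _ rfl; exact .inl ⟨_, rfl, by simp, by simp⟩⟩
  | imp A B =>
    intro b' hb'
    refine ⟨_, rfl, by simp, fun x' hx' => ?_⟩
    by_cases he : A.imp B = E.imp F
    · rw [he, replace_self] at hb'
      exact .inr ⟨he.symm, b', hb', hx', subset_rfl⟩
    · rw [replace_imp_of_ne he] at hb'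
      obtain rfl := hb'
      exact .inl ⟨_, rfl, he, by rw [replace_imp_of_ne he]; exact hx'⟩
  | box => exact hA.elim
  | or A B h₁ h₂ =>
    rw [replace_or]
    rintro b' (hb' | hb')
    · obtain ⟨b, hb, h⟩ := h₁ hA.1 hb'
      exact ⟨b, .inl hb, h⟩
    · obtain ⟨b, hb, h⟩ := h₂ hA.2 hb'
      exact ⟨b, .inr hb, h⟩
  | and A B h₁ h₂ =>
    rw [replace_and]
    rintro _ ⟨b₁', hb₁', b₂', hb₂', rfl⟩
    obtain ⟨b₁, hb₁, hl₁, H₁⟩ := h₁ hA.1 hb₁'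
    obtain ⟨b₂, hb₂, hl₂, H₂⟩ := h₂ hA.2 hb₂'
    refine ⟨_, ⟨b₁, hb₁, b₂, hb₂, rfl⟩, ?_, ?_⟩
    · rintro x ⟨hx | hx, h⟩
      · exact lits_mono Set.subset_union_left (hl₁ ⟨hx, h⟩)
      · exact lits_mono Set.subset_union_right (hl₂ ⟨hx, h⟩)
    · rintro x' (hx' | hx')
      · obtain ⟨x, hx, h⟩ | ⟨he, c, hc, hxc, h⟩ := H₁ x' hx'
        · exact .inl ⟨x, .inl hx, h⟩
        · exact .inr ⟨.inl he, c, hc, hxc, h.trans Set.subset_union_left⟩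
      · obtain ⟨x, hx, h⟩ | ⟨he, c, hc, hxc, h⟩ := H₂ x' hx'
        · exact .inl ⟨x, .inr hx, h⟩
        · exact .inr ⟨.inr he, c, hc, hxc, h.trans Set.subset_union_right⟩

theorem isSimple_of_mem_cases {b : Set (Form β)} (hb : b ∈ cases A) : ∀ x ∈ b, x.IsSimple := by
  induction A generalizing b with
  | top => rintro x hx; rw [show b = ∅ from hb] at hx; exact hx.elim
  | atom | bot | imp | box => obtain rfl := hb; rintro x rfl; trivial
  | and A B h₁ h₂ =>
    obtain ⟨a, ha, b, hb, rfl⟩ := hb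
    rintro x (hx | hx)
    exacts [h₁ ha x hx, h₂ hb x hx]
  | or A B h₁ h₂ => exact hb.elim h₁ h₂

end Cases

/-! ### Formulas whose antecedents are stable under boxing -/

/-- `Stable s true Γ A`: in the context `Γ`, every antecedent in a positive position of `A` is
stable. `Stable s false Γ B`: every case `b` of the antecedent `B` derives its own boxing already
from the variables in `b` and from `Γ`, and this holds hereditarily for the implications
in `b`. -/
inductive Stable (s : β → Form α) : Bool → Set (Form β) → Form β → Prop
  | atom {Γ : Set (Form β)} (a : β) : Stable s true Γ (atom a)
  | bot {Γ : Set (Form β)} : Stable s true Γ bot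
  | top {Γ : Set (Form β)} : Stable s true Γ top
  | and {Γ : Set (Form β)} {A B : Form β} :
      Stable s true Γ A → Stable s true Γ B → Stable s true Γ (A.and B)
  | or {Γ : Set (Form β)} {A B : Form β} :
      Stable s true Γ A → Stable s true Γ B → Stable s true Γ (A.or B)
  | imp {Γ : Set (Form β)} {B C : Form β} :
      Stable s false Γ B → (∀ b ∈ cases B, Stable s true (Γ ∪ lits b) C) →
      Stable s true Γ (B.imp C)
  | ante {Γ : Set (Form β)} {B : Form β} :
      (∀ b ∈ cases B, ∀ x ∈ b, Entails s (Γ ∪ lits b) x.box) →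
      (∀ b ∈ cases B, ∀ E F, imp E F ∈ b → Stable s true (Γ ∪ lits b) E) →
      (∀ b ∈ cases B, ∀ E F, imp E F ∈ b → Stable s false (Γ ∪ lits b) F) →
      Stable s false Γ B

namespace Stable

variable {s : β → Form α} {S : Set β} {t : Bool} {Γ Δ : Set (Form β)} {A B C D E F : Form β}

theorem mono (h : Stable s t Γ A) (hΓ : Γ ⊆ Δ) : Stable s t Δ A := by
  induction h generalizing Δ with
  | atom a => exact .atom a
  | bot => exact .bot
  | top => exact .top
  | and _ _ h₁ h₂ => exact .and (h₁ hΓ) (h₂ hΓ)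
  | or _ _ h₁ h₂ => exact .or (h₁ hΓ) (h₂ hΓ)
  | imp _ _ h₁ h₂ => exact .imp (h₁ hΓ) fun b hb => h₂ b hb (Set.union_subset_union_left _ hΓ)
  | ante h _ _ h₁ h₂ =>
    have h' := fun b => Set.union_subset_union_left (lits b) hΓ
    exact .ante (fun b hb x hx => (h b hb x hx).mono (h' b))
      (fun b hb E F he => h₁ b hb E F he (h' b)) fun b hb E F he => h₂ b hb E F he (h' b)

theorem box (h : Stable s false Γ B) {b : Set (Form β)} (hb : b ∈ cases B) :
    ∀ x ∈ b, Entails s (Γ ∪ lits b) x.box := by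
  cases h with | ante h _ _ => exact h b hb

theorem box_self (h : Stable s false Γ B) {b : Set (Form β)} (hb : b ∈ cases B) :
    Entails s (Γ ∪ lits b) B.box :=
  (entails_of_mem_cases hb fun _ hx => .hyp hx).box_cut (h.box hb)

theorem ante_left (h : Stable s false Γ B) {b : Set (Form β)} (hb : b ∈ cases B)
    (he : E.imp F ∈ b) : Stable s true (Γ ∪ lits b) E := by
  cases h with | ante _ h _ => exact h b hb E F he

theorem ante_right (h : Stable s false Γ B) {b : Set (Form β)} (hb : b ∈ cases B)
    (he : E.imp F ∈ b) : Stable s false (Γ ∪ lits b) F := by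
  cases h with | ante _ _ h => exact h b hb E F he

theorem imp_right (h : Stable s false Γ (E.imp F)) : Stable s false Γ F := by
  simpa using h.ante_right (b := {E.imp F}) rfl rfl

/-- A case of the conjunction contains a case of `A`, so the literals of the latter may be used when
`B` is examined. This fits the antecedent `B' ∧ E` made by `[B]'`, where `B'` is stable only in the
presence of `E`. -/
theorem ante_and (hA : Stable s false Γ A)
    (hB : ∀ a ∈ cases A, Stable s false (Γ ∪ lits a) B) : Stable s false Γ (B.and A) := by
  have hl : ∀ a b : Set (Form β), Γ ∪ lits a ⊆ Γ ∪ lits (b ∪ a) := fun a b =>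
    Set.union_subset_union_right _ (lits_mono Set.subset_union_right)
  have hr : ∀ a b : Set (Form β), Γ ∪ lits a ∪ lits b ⊆ Γ ∪ lits (b ∪ a) := fun a b =>
    Set.union_subset (hl a b)
      ((lits_mono Set.subset_union_left).trans Set.subset_union_right)
  refine .ante ?_ ?_ ?_
  · rintro _ ⟨b, hb, a, ha, rfl⟩ x (hx | hx)
    exacts [((hB a ha).box hb x hx).mono (hr a b), (hA.box ha x hx).mono (hl a b)]
  · rintro _ ⟨b, hb, a, ha, rfl⟩ E F (hx | hx)
    exacts [((hB a ha).ante_left hb hx).mono (hr a b), (hA.ante_left ha hx).mono (hl a b)]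
  · rintro _ ⟨b, hb, a, ha, rfl⟩ E F (hx | hx)
    exacts [((hB a ha).ante_right hb hx).mono (hr a b), (hA.ante_right ha hx).mono (hl a b)]

theorem ante_isConj {X : Finset (Form β)} (h : IsConj X B) (hX : ∀ x ∈ X, Stable s false Γ x) :
    Stable s false Γ B := by
  induction h with
  | empty =>
    refine .ante ?_ ?_ ?_ <;> rintro _ rfl <;> rintro _ ⟨⟩ <;> intros <;> contradiction
  | single A => exact hX A (by simp)
  | and _ _ h₁ h₂ =>
    exact ante_and (h₂ fun x hx => hX x (Finset.mem_union_right _ hx)) fun a _ =>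
      (h₁ fun x hx => hX x (Finset.mem_union_left _ hx)).mono Set.subset_union_left

theorem ante_of_cases (h : Stable s false Γ B) (hC : ∀ b ∈ cases C, b ∈ cases B) :
    Stable s false Γ C :=
  .ante (fun b hb => h.box (hC b hb)) (fun b hb _ _ he => h.ante_left (hC b hb) he)
    fun b hb _ _ he => h.ante_right (hC b hb) he

theorem fill {J : OuterCtx β} (h : Stable s true Γ (J.fill D))
    (hE : Stable s true Γ D → Stable s true Γ E) : Stable s true Γ (J.fill E) := by
  induction J with
  | hole => exact hE h
  | andL J A ih => cases h with | and h₁ h₂ => exact .and (ih h₁) h₂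
  | andR A J ih => cases h with | and h₁ h₂ => exact .and h₁ (ih h₂)
  | orL J A ih => cases h with | or h₁ h₂ => exact .or (ih h₁) h₂
  | orR A J ih => cases h with | or h₁ h₂ => exact .or h₁ (ih h₂)

theorem listDisj : ∀ {l : List (Form β)}, (∀ x ∈ l, Stable s true Γ x) →
    Stable s true Γ (listDisj l)
  | [], _ => .bot
  | [A], h => h A (by simp)
  | _ :: _ :: _, h => .or (h _ (by simp)) (listDisj fun x hx => h x (by simp_all))

theorem disj {X : Finset (Form β)} (h : ∀ x ∈ X, Stable s true Γ x) :
    Stable s true Γ (disj X) :=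
  listDisj (by simpa using h)

/-- In the presence of a case `e` of `E`, the formulas `E → F` and `F` are interchangeable. Since
`Δ` proves the boxes of the members of `e`, they remain interchangeable under a box, which is what
the self-boxing condition on antecedents requires. -/
theorem replace (h : Stable s t Γ A) (hA : Over S A) (hΓ : Γ ⊆ Δ) {e : Set (Form β)}
    (he : e ∈ cases E) (hle : lits e ⊆ Δ) (hbe : ∀ x ∈ e, Entails s Δ x.box) :
    Stable s t Δ (replace (E.imp F) F A) := by
  induction h generalizing Δ with
  | atom a => simpa using .atom a
  | bot => simpa using .bot
  | top => simpa using .top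
  | and _ _ h₁ h₂ => simpa using .and (h₁ hA.1 hΓ hle hbe) (h₂ hA.2 hΓ hle hbe)
  | or _ _ h₁ h₂ => simpa using .or (h₁ hA.1 hΓ hle hbe) (h₂ hA.2 hΓ hle hbe)
  | @imp Γ B C hB hC h₁ h₂ =>
    by_cases heq : B.imp C = E.imp F
    · obtain ⟨rfl, rfl⟩ := by simpa using heq
      rw [replace_self]
      -- The replaced occurrence becomes `F` alone, which is stable given the literals of the case
      -- `e` of its former antecedent; these lie in `Δ`.
      exact (hC e he).mono (Set.union_subset hΓ hle)
    · rw [replace_imp_of_ne heq]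
      refine .imp (h₁ hA.1 hΓ hle hbe) fun b' hb' => ?_
      obtain ⟨b, hb, hl, -⟩ := exists_case_of_replace hA.1 hb'
      exact h₂ b hb hA.2 (Set.union_subset_union hΓ hl) (hle.trans Set.subset_union_left)
        fun x hx => (hbe x hx).mono Set.subset_union_left
  | @ante Γ B h hE hF h₁ h₂ =>
    have hB : Stable s false Γ B := .ante h hE hF
    have key : ∀ b' ∈ cases (Form.replace (E.imp F) F B), ∀ x' ∈ b',
        Entails s (Δ ∪ lits b') x'.box ∧ ∀ G H, x' = G.imp H →
          Stable s true (Δ ∪ lits b') G ∧ Stable s false (Δ ∪ lits b') H := by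
      intro b' hb' x' hx'
      have hle' : lits e ⊆ Δ ∪ lits b' := hle.trans Set.subset_union_left
      have hbe' : ∀ x ∈ e, Entails s (Δ ∪ lits b') x.box := fun x hx =>
        (hbe x hx).mono Set.subset_union_left
      obtain ⟨b, hb, hl, H⟩ := exists_case_of_replace hA hb'
      have hsub := Set.union_subset_union hΓ hl
      obtain ⟨x, hx, hne, rfl⟩ | ⟨he', c, hc, hxc, hcb⟩ := H x' hx'
      · have hxo := over_of_mem_cases hA hb x hx
        constructor
        -- The case `e` proves `E`, so `x` and `e` together prove the replaced `x`; boxing this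
        -- derivation reduces the goal to the boxes of `x` and of `e`.
        · have hE : Entails s (insert x e) (Form.replace (E.imp F) F x) :=
            (Entails.replace_iff hxo (entails_of_mem_cases he fun _ hy => .hyp (.inr hy))).2 .head
          refine hE.box_cut fun y hy => ?_
          rcases hy with rfl | hy
          · exact (h b hb _ hx).mono hsub
          · exact hbe' y hy
        · intro G H hGH
          have hsimp := isSimple_of_mem_cases hb x hx
          cases x with
          | and | or => exact hsimp.elim
          | box => exact hxo.elim
          | atom | bot | top => simp at hGH
          | imp x y =>
            rw [replace_imp_of_ne hne] at hGH
            obtain ⟨rfl, rfl⟩ := by simpa using hGH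
            exact ⟨h₁ b hb x y hx hxo.1 hsub hle' hbe', h₂ b hb x y hx hxo.2 hsub hle' hbe'⟩
      -- Here `E → F` itself was a member of `b` and a whole case `c` of `F` took its place; the
      -- hereditary condition on `F` takes over.
      · have hFs : Stable s false (Γ ∪ lits b) F := hB.ante_right hb he'
        have hsub' : Γ ∪ lits b ∪ lits c ⊆ Δ ∪ lits b' :=
          Set.union_subset hsub ((lits_mono hcb).trans Set.subset_union_right)
        refine ⟨(hFs.box hc _ hxc).mono hsub', ?_⟩
        rintro G H rfl
        exact ⟨(hFs.ante_left hc hxc).mono hsub', (hFs.ante_right hc hxc).mono hsub'⟩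
    exact .ante (fun b' hb' x' hx' => (key b' hb' x' hx').1)
      (fun b' hb' G H hx' => ((key b' hb' _ hx').2 G H rfl).1)
      fun b' hb' G H hx' => ((key b' hb' _ hx').2 G H rfl).2

theorem bracket (hB : Stable s false Γ B) (hE : Stable s true Γ E) :
    Stable s true Γ (bracket B E) := by
  induction E with
  | atom | bot | top => exact hE
  | and _ _ h₁ h₂ => cases hE with | and h h' => exact .and (h₁ h) (h₂ h')
  | or _ _ h₁ h₂ => cases hE with | or h h' => exact .or (h₁ h) (h₂ h')
  | imp => exact .imp hB fun b _ => hE.mono Set.subset_union_left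
  | box => cases hE

theorem bracket' (hB : Stable s false Γ B) (hE : Stable s true Γ E) (hBS : Over S B) :
    Stable s true Γ (bracket' B E) := by
  induction E with
  | atom | bot | top => exact hE
  | and _ _ h₁ h₂ => cases hE with | and h h' => exact .and (h₁ h) (h₂ h')
  | or _ _ h₁ h₂ => cases hE with | or h h' => exact .or (h₁ h) (h₂ h')
  | imp =>
    cases hE with
    | imp h h' =>
      refine .imp (ante_and h fun a ha => ?_) ?_
      · exact hB.replace hBS Set.subset_union_left ha Set.subset_union_right (h.box ha)
      · rintro _ ⟨b, _, a, ha, rfl⟩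
        exact (h' a ha).mono
          (Set.union_subset_union_right _ (lits_mono Set.subset_union_right))
  | box => cases hE

end Stable

/-! ### Soundness of the NNIL-algorithm -/

section

variable {S : Set β} {s : β → Form α} {A B C Q : Form β}

/-- Besides excluding boxes, this shows that no new variables appear in an output. It matters
because the approximations put under the boxes are known to be correct only for the outermost boxed
subformulas of the input. -/
theorem NNILOut.over (h : NNILOut A Q) (hA : Over S A) : Over S Q := by
  induction h with
  | atomOrBox | bot | top => exact hA
  | and _ _ h₁ h₂ => exact ⟨h₁ hA.1, h₂ hA.2⟩
  | or _ _ h₁ h₂ => exact ⟨h₁ hA.1, h₂ hA.2⟩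
  | impAnd J _ _ h₁ h₂ =>
    exact ⟨h₁ ⟨hA.1, over_fill_congr hA.2 And.left⟩, h₂ ⟨hA.1, over_fill_congr hA.2 And.right⟩⟩
  | orImp J _ _ h₁ h₂ =>
    exact ⟨h₁ ⟨over_fill_congr hA.1 And.left, hA.2⟩, h₂ ⟨over_fill_congr hA.1 And.right, hA.2⟩⟩
  | impAtom hX _ _ _ hp _ _ ih =>
    have h := hX.over hA.1
    exact ⟨h _ hp, ih ⟨over_conj fun x hx => h x (Finset.mem_sdiff.1 hx).1, hA.2⟩⟩
  | impTop hX _ _ _ _ _ ih =>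
    exact ih ⟨over_conj fun x hx => hX.over hA.1 x (Finset.mem_sdiff.1 hx).1, hA.2⟩
  | impBot => trivial
  | impImps g hX _ _ _ _ _ h₁ h₂ =>
    refine ⟨over_conj fun x hx => ?_, h₂ (over_bracketSet hX hA.1 hA.2)⟩
    obtain ⟨D, hD, rfl⟩ := Finset.mem_image.1 hx
    exact h₁ D hD ⟨over_down hX hA.1 hD, hA.2⟩
  | impImps' g hX _ _ _ _ _ h₁ h₂ =>
    refine ⟨over_conj fun x hx => ?_, h₂ (over_bracketSet' hX hA.1 hA.2)⟩
    obtain ⟨D, hD, rfl⟩ := Finset.mem_image.1 hx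
    exact h₁ D hD ⟨over_down hX hA.1 hD, hA.2⟩

theorem Entails.empty (h : Entails s ∅ A) {Γ : Set (Form β)} : Entails s Γ A :=
  h.mono (Set.empty_subset _)

theorem Entails.down {X : Finset (Form β × Form β)} {D : Form β × Form β} {Γ : Set (Form β)}
    (hX : IsConj (imps X) B) (hB : Entails s Γ B) (hD : Entails s Γ D.2) :
    Entails s Γ (down X D) :=
  conj_intro fun x hx => by
    obtain rfl | hx := mem_down hx
    exacts [hD, (isConj_iff hX).1 hB x hx]

theorem Entails.of_down {X : Finset (Form β × Form β)} {D : Form β × Form β} {Γ : Set (Form β)}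
    (hX : IsConj (imps X) B) (h : Entails s Γ (Form.down X D)) : Entails s Γ B := by
  refine (isConj_iff hX).2 fun x hx => ?_
  by_cases hxD : x = toImp D
  · subst hxD
    exact (conj_elim h (by simp)).const
  · exact conj_elim h (by simp [hx, hxD])

/-- Given `B`, some member `E` of `Z` holds. Either it is `C`, or it is the antecedent of some `D =
(E → F)` in `X`; then `F` follows, hence `B ↓ D`, hence `C`. The map `br` stands for either bracket.
-/
theorem Entails.imp_of_bracketSet {X : Finset (Form β × Form β)} {Γ : Set (Form β)}
    {br : Form β → Form β} (hX : IsConj (imps X) B)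
    (hbr : ∀ {Γ : Set (Form β)} {E : Form β}, Entails s Γ B → Entails s Γ (br E) → Entails s Γ E)
    (h₁ : ∀ D ∈ X, Entails s Γ ((Form.down X D).imp C))
    (h₂ : Entails s Γ (disj ((zSet X C).image br))) : Entails s Γ (B.imp C) := by
  refine .imp_intro (h₂.weaken.disj_elim fun x hx => ?_)
  obtain ⟨E, hE, rfl⟩ := Finset.mem_image.1 hx
  have hB : Entails s (insert (br E) (insert B Γ)) B := Entails.head.weaken
  have hE' := hbr hB .head
  obtain rfl | ⟨F, hF⟩ := mem_zSet.1 hE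
  · exact hE'
  · exact (h₁ _ hF).weaken.weaken.mp
      (.down hX hB (((isConj_iff hX).1 hB _ (mem_imps.2 hF)).mp hE'))

theorem NNILOut.entails (h : NNILOut A Q) (hA : Over S A) :
    ∀ {Γ : Set (Form β)}, Entails s Γ Q → Entails s Γ A := by
  induction h with
  | atomOrBox | bot | top => exact id
  | and _ _ h₁ h₂ => exact fun h => (h₁ hA.1 h.left).and_intro (h₂ hA.2 h.right)
  | or _ _ h₁ h₂ => exact fun h => h.or_elim (h₁ hA.1 .head).inl (h₂ hA.2 .head).inr
  | impAnd J _ _ h₁ h₂ =>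
    exact fun h => .imp_intro (.fill_and
      (h₁ ⟨hA.1, over_fill_congr hA.2 And.left⟩ h.left).imp_elim
      (h₂ ⟨hA.1, over_fill_congr hA.2 And.right⟩ h.right).imp_elim)
  | orImp J _ _ h₁ h₂ =>
    exact fun h => .imp_intro ((Entails.fill_or .head).or_elim
      ((h₁ ⟨over_fill_congr hA.1 And.left, hA.2⟩ h.left).weaken.imp_elim)
      ((h₂ ⟨over_fill_congr hA.1 And.right, hA.2⟩ h.right).weaken.imp_elim))
  | impAtom hX _ _ _ hp _ _ ih =>
    intro Γ h
    have hB := fun {Γ} => (Entails.isConj_iff (s := s) (Γ := Γ) hX).1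
    exact .imp_intro ((ih ⟨over_conj fun x hx => hX.over hA.1 x (Finset.mem_sdiff.1 hx).1, hA.2⟩
      (h.weaken.mp (hB .head _ hp))).mp
        (.conj_intro fun x hx => hB .head x (Finset.mem_sdiff.1 hx).1))
  | impTop hX _ _ _ _ _ ih =>
    intro Γ h
    exact .imp_intro
      ((ih ⟨over_conj fun x hx => hX.over hA.1 x (Finset.mem_sdiff.1 hx).1, hA.2⟩ h.weaken).mp
        (.conj_intro fun x hx => (Entails.isConj_iff hX).1 .head x (Finset.mem_sdiff.1 hx).1))
  | impBot hX _ _ _ hb => exact fun _ => .imp_intro ((Entails.isConj_iff hX).1 .head _ hb).bot_elim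
  | impImps g hX _ _ _ _ _ h₁ h₂ =>
    exact fun h => .imp_of_bracketSet hX .of_bracket
      (fun D hD => h₁ D hD ⟨over_down hX hA.1 hD, hA.2⟩
        (h.left.conj_elim (Finset.mem_image_of_mem g hD)))
      (h₂ (over_bracketSet hX hA.1 hA.2) h.right)
  | impImps' g hX _ _ _ _ _ h₁ h₂ =>
    exact fun h => .imp_of_bracketSet hX (.of_bracket' hA.1)
      (fun D hD => h₁ D hD ⟨over_down hX hA.1 hD, hA.2⟩
        (h.left.conj_elim (Finset.mem_image_of_mem g hD)))
      (h₂ (over_bracketSet' hX hA.1 hA.2) h.right)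

end

/-! ### Preservativity under a context of variables -/

section

variable {s : β → Form α} {A B C E : Form β}

theorem subst_atom (A : Form α) : A.subst atom = A := by
  induction A <;> simp_all [subst]

/-- The bracket leaves a variable unchanged, and it also leaves unchanged the atomic or boxed
formula substituted for it. -/
theorem subst_bracket (hs : ∀ b, (s b).IsAtomOrBox) :
    (bracket B E).subst s = bracket (B.subst s) (E.subst s) := by
  induction E with
  | atom a =>
    have := hs a
    simp only [bracket, subst]
    generalize s a = x at this
    cases x <;> first | rfl | exact this.elim
  | bot | top | imp | box => rfl
  | and _ _ h₁ h₂ => simp [bracket, subst, h₁, h₂]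
  | or _ _ h₁ h₂ => simp [bracket, subst, h₁, h₂]

theorem IsConj.subst {X : Finset (Form β)} (h : IsConj X B) :
    IsConj (X.image (Form.subst s)) (B.subst s) := by
  induction h with
  | empty => exact .empty
  | single A => exact .single _
  | and _ _ h₁ h₂ => rw [Finset.image_union]; exact .and h₁ h₂

theorem image_imps (X : Finset (Form β × Form β)) : (imps X).image (subst s) =
    imps (X.image (Prod.map (subst s) (subst s))) := by
  simp [imps, Finset.image_image, Function.comp_def, toImp, subst]

theorem IsAtomOrBox.subst (hs : ∀ b, (s b).IsAtomOrBox) (hA : A.IsAtomOrBox) :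
    (A.subst s).IsAtomOrBox := by
  cases A with
  | atom a => exact hs a
  | box => trivial
  | _ => exact hA.elim

/-- Substitution may identify members of `Z`, and `disj` fixes an arbitrary order. The disjunction
given by B2 thus need not be the substituted one literally, but it implies it. -/
theorem Pres.bracketSet_subst (hs : ∀ b, (s b).IsAtomOrBox) {X : Finset (Form β × Form β)}
    (hX : IsConj (imps X) B) :
    Pres (((B.imp C).and B.box).subst s) ((bracketSet B (zSet X C)).subst s) := by
  have hX' : IsConj (imps (X.image (Prod.map (Form.subst s) (Form.subst s)))) (B.subst s) := by
    rw [← image_imps]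
    exact hX.subst
  refine .A2 (.B2 (C := C.subst s) hX') (.A1 ?_)
  have key : Entails atom {bracketSet (B.subst s)
      (zSet (X.image (Prod.map (Form.subst s) (Form.subst s))) (C.subst s))}
      ((bracketSet B (zSet X C)).subst s) := by
    refine Entails.disj_elim (.hyp rfl) fun x hx => ?_
    obtain ⟨E', hE', rfl⟩ := Finset.mem_image.1 hx
    obtain ⟨E, hE, rfl⟩ : ∃ E ∈ zSet X C, E' = E.subst s := by
      obtain rfl | ⟨F, hF⟩ := mem_zSet.1 hE'
      · exact ⟨C, mem_zSet.2 (.inl rfl), rfl⟩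
      · obtain ⟨⟨E, F⟩, h, h'⟩ := Finset.mem_image.1 hF
        exact ⟨E, mem_zSet.2 (.inr ⟨F, h⟩), (Prod.mk.inj h').1.symm⟩
    have h : Entails s {bracket B E} (bracketSet B (zSet X C)) :=
      .disj_intro (.hyp rfl) (Finset.mem_image_of_mem _ hE)
    rw [← subst_bracket hs]
    refine .mp (.thm ?_) .head
    rw [subst_atom]
    exact h.ik4_imp
  simpa [subst_atom] using key.ik4_imp

/-- `σ₁ → σ₂ → ⋯ → A`. -/
def ctxImp (σ : List (Form β)) (A : Form β) : Form β := σ.foldr imp A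

theorem entails_ctxImp {σ : List (Form β)} : ∀ {Γ : Set (Form β)},
    Entails s Γ (ctxImp σ A) ↔ Entails s (Γ ∪ {x | x ∈ σ}) A := by
  induction σ with
  | nil => simp [ctxImp]
  | cons p σ ih =>
    intro Γ
    have h : Entails s Γ (ctxImp (p :: σ) A) ↔ Entails s (insert p Γ) (ctxImp σ A) :=
      ⟨fun h => h.imp_elim, fun h => .imp_intro h⟩
    rw [h, ih]
    have : insert p Γ ∪ {x | x ∈ σ} = Γ ∪ {x | x ∈ p :: σ} := by
      ext x; simp; tauto
    rw [this]

/-- `A ▸ B` in the context `σ`, after the substitution `s`. -/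
def CtxPres (s : β → Form α) (σ : List (Form β)) (A B : Form β) : Prop :=
  Pres ((ctxImp σ A).subst s) ((ctxImp σ B).subst s)

namespace CtxPres

variable {σ : List (Form β)}

theorem of_entails (h : Entails s (insert A {x | x ∈ σ}) B) : CtxPres s σ A B := by
  refine .A1 (Entails.ik4_imp (entails_ctxImp.2 (h.cut ?_)))
  rintro x (rfl | hx)
  · exact entails_ctxImp.1 (.hyp rfl)
  · exact .hyp (.inr hx)

theorem trans (h₁ : CtxPres s σ A B) (h₂ : CtxPres s σ B C) : CtxPres s σ A C := .A2 h₁ h₂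

theorem and_intro (h₁ : CtxPres s σ A B) (h₂ : CtxPres s σ A C) : CtxPres s σ A (B.and C) := by
  refine .A2 (.A3 h₁ h₂) (.A1 (Entails.ik4_imp (A := (ctxImp σ B).and (ctxImp σ C)) ?_))
  exact entails_ctxImp.2 ((entails_ctxImp.1 (Entails.single.left)).and_intro
    (entails_ctxImp.1 (Entails.single.right)))

theorem listConj_intro : ∀ {l : List (Form β)}, (∀ x ∈ l, CtxPres s σ A x) →
    CtxPres s σ A (listConj l)
  | [], _ => of_entails .top
  | [B], h => h B (by simp)
  | _ :: _ :: _, h => and_intro (h _ (by simp)) (listConj_intro fun x hx => h x (by simp_all))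

theorem conj_intro {X : Finset (Form β)} (h : ∀ x ∈ X, CtxPres s σ A x) :
    CtxPres s σ A (conj X) :=
  listConj_intro (by simpa using h)

theorem of_pres (hs : ∀ b, (s b).IsAtomOrBox) (hσ : ∀ x ∈ σ, x.IsAtomOrBox)
    (h : Pres (A.subst s) (B.subst s)) : CtxPres s σ A B := by
  unfold CtxPres
  induction σ with
  | nil => exact h
  | cons p σ ih =>
    exact .B3 ((hσ p (by simp)).subst hs) (ih fun x hx => hσ x (by simp [hx]))

theorem or_congr (hs : ∀ b, (s b).IsAtomOrBox) (hσ : ∀ x ∈ σ, x.IsAtomOrBox) {A' B' : Form β}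
    (h₁ : CtxPres s σ A A') (h₂ : CtxPres s σ B B') : CtxPres s σ (A.or B) (A'.or B') := by
  have hl : ∀ A, Pres (A.subst s) ((ctxImp σ A).subst s) := fun A =>
    .A1 (Entails.ik4_imp (entails_ctxImp.2 (.hyp (.inl rfl))))
  have h : Pres ((A.or B).subst s) ((ctxImp σ (A'.or B')).subst s) := by
    refine .B1 (.A2 (hl A) (.A2 h₁ ?_)) (.A2 (hl B) (.A2 h₂ ?_))
    · exact .A1 (Entails.ik4_imp (entails_ctxImp.2 (entails_ctxImp.1 .single).inl))
    · exact .A1 (Entails.ik4_imp (entails_ctxImp.2 (entails_ctxImp.1 .single).inr))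
  -- Rule B1 has no side premises, so the context was put into its conclusion. Prefixing `σ` to both
  -- sides makes it occur twice on the right, and the two copies contract.
  refine (of_pres hs hσ h).trans (of_entails ?_)
  refine ((entails_ctxImp (σ := σ)).1 (.head (Γ := {x | x ∈ σ}))).mono ?_
  rintro x (hx | hx)
  exacts [hx, .inr hx]

/-- The context `p :: σ` has `p` as its outermost premise, whereas the algorithm leaves `p`
innermost, directly before `B`; the two orders are equivalent in `iK4`. -/
theorem imp_intro {p : Form β} (h : CtxPres s (p :: σ) A B) (hC : Entails s {C, p} A) :
    CtxPres s σ C (p.imp B) := by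
  have hσ : ∀ {A Γ}, Entails s Γ (ctxImp (p :: σ) A) ↔ Entails s Γ (ctxImp σ (p.imp A)) := by
    intro A Γ
    rw [entails_ctxImp, entails_ctxImp]
    have : Γ ∪ {x | x ∈ p :: σ} = insert p (Γ ∪ {x | x ∈ σ}) := by ext; simp; tauto
    rw [this]
    exact ⟨fun h => h.imp_intro, fun h => h.imp_elim⟩
  have h₁ : CtxPres s σ C (p.imp A) :=
    of_entails (.imp_intro (hC.mono (by rintro x (rfl | rfl) <;> simp)))
  exact .A2 h₁ (.A2 (.A1 (Entails.ik4_imp (hσ.2 (.hyp rfl))))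
    (.A2 h (.A1 (Entails.ik4_imp (hσ.1 (.hyp rfl))))))

end CtxPres

end

/-! ### Stable formulas are preserved into their NNIL-approximations -/

theorem lits_sdiff_eq_empty {X : Finset (Form β × Form β)} {T : Set (Form β)} :
    lits ((imps X : Set (Form β)) \ T) = ∅ := by
  refine Set.eq_empty_of_forall_notMem ?_
  rintro x ⟨⟨hx, -⟩, h⟩
  obtain ⟨E, F, rfl, -⟩ := exists_of_mem_imps (Finset.mem_coe.1 hx)
  exact h

section

variable {s : β → Form α} {S : Set β} {Γ : Set (Form β)} {A B C Q : Form β}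
  {X : Finset (Form β × Form β)}

theorem cases_isConj_imps (hX : IsConj (imps X) B) :
    cases B = {(imps X : Set (Form β)) \ {top}} := by
  refine cases_isConj hX fun x hx => ?_
  obtain ⟨E, F, rfl, -⟩ := exists_of_mem_imps hx
  trivial

theorem Stable.succ_of_imps (h : Stable s true Γ (B.imp C)) (hX : IsConj (imps X) B) :
    Stable s true Γ C := by
  cases h with
  | imp _ h =>
    have := h _ (by rw [cases_isConj_imps hX]; rfl)
    rwa [lits_sdiff_eq_empty, Set.union_empty] at this

theorem Stable.zSet_of_imps (h : Stable s true Γ (B.imp C)) (hX : IsConj (imps X) B) :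
    ∀ x ∈ zSet X C, Stable s true Γ x := by
  intro x hx
  obtain rfl | ⟨F, hF⟩ := mem_zSet.1 hx
  · exact h.succ_of_imps hX
  · cases h with
    | imp h _ =>
      have := h.ante_left (E := x) (F := F) (b := (imps X : Set (Form β)) \ {Form.top})
        (by rw [cases_isConj_imps hX]; rfl)
        ⟨mem_imps.2 hF, by simp⟩
      rwa [lits_sdiff_eq_empty, Set.union_empty] at this

theorem Stable.down_of_imps (h : Stable s true Γ (B.imp C)) (hX : IsConj (imps X) B)
    {D : Form β × Form β} (hD : D ∈ X) : Stable s true Γ ((down X D).imp C) := by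
  have hC := h.succ_of_imps hX
  refine .imp (ante_isConj (isConj_conj _) fun x hx => ?_) fun b _ =>
    hC.mono Set.subset_union_left
  have key : ∀ E F, (E, F) ∈ X → Stable s false Γ (E.imp F) := by
    intro E F hF
    cases h with
    | imp h _ =>
      have hb : (imps X : Set (Form β)) \ {Form.top} ∈ cases B := by
        rw [cases_isConj_imps hX]; rfl
      have hm : E.imp F ∈ (imps X : Set (Form β)) \ {Form.top} := ⟨mem_imps.2 hF, by simp⟩
      have h₁ := h.box hb _ hm
      have h₂ := h.ante_left hb hm
      have h₃ := h.ante_right hb hm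
      rw [lits_sdiff_eq_empty, Set.union_empty] at h₁ h₂ h₃
      refine .ante ?_ ?_ ?_
      · rintro _ rfl _ rfl
        simpa using h₁
      · rintro _ rfl G H hGH
        obtain ⟨rfl, rfl⟩ := by simpa using hGH
        simpa using h₂
      · rintro _ rfl G H hGH
        obtain ⟨rfl, rfl⟩ := by simpa using hGH
        simpa using h₃
  obtain rfl | hx := mem_down hx
  · exact (key _ _ hD).imp_right
  · obtain ⟨E, F, rfl, hF⟩ := exists_of_mem_imps hx
    exact key E F hF

/-- The only case of `B` consists of implications and has no literals, so its self-boxing relies on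
the context alone. This supplies the boxed conjunct required by B2. -/
theorem Stable.box_of_imps (h : Stable s true Γ (B.imp C)) (hX : IsConj (imps X) B) :
    Entails s Γ B.box := by
  cases h with
  | imp h _ =>
    have := h.box_self (by rw [cases_isConj_imps hX]; rfl)
    rwa [lits_sdiff_eq_empty, Set.union_empty] at this

/-- A removed literal is already in `Γ`, so the remaining case together with `Γ` still contains
every literal used before. -/
theorem Stable.sdiff {X : Finset (Form β)} (h : Stable s true Γ (B.imp C)) (hX : IsConj X B)
    (hs : ∀ x ∈ X, x.IsSimple) {p : Form β} (hΓ : lits {p} ⊆ Γ) :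
    Stable s true Γ ((conj (X \ {p})).imp C) := by
  have hc : cases (conj (X \ {p})) = {((X \ {p} : Finset (Form β)) : Set (Form β)) \ {Form.top}} :=
    cases_isConj (isConj_conj _) fun x hx => hs x (Finset.mem_sdiff.1 hx).1
  have hb : (X : Set (Form β)) \ {Form.top} ∈ cases B := by rw [cases_isConj hX hs]; rfl
  have hsub : ((X \ {p} : Finset (Form β)) : Set (Form β)) \ {Form.top} ⊆
      (X : Set (Form β)) \ {Form.top} := fun x hx =>
    ⟨Finset.mem_coe.2 (Finset.mem_sdiff.1 (Finset.mem_coe.1 hx.1)).1, hx.2⟩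
  have hl : Γ ∪ lits ((X : Set (Form β)) \ {Form.top}) ⊆
      Γ ∪ lits (((X \ {p} : Finset (Form β)) : Set (Form β)) \ {Form.top}) := by
    rintro x (hx | ⟨hx, hl⟩)
    · exact .inl hx
    · by_cases hxp : x = p
      · exact .inl (hΓ ⟨hxp, hl⟩)
      · exact .inr ⟨⟨by simpa using ⟨hx.1, hxp⟩, hx.2⟩, hl⟩
  cases h with
  | imp h₁ h₂ =>
    refine .imp (.ante ?_ ?_ ?_) ?_ <;> rw [hc] <;> rintro _ rfl
    · exact fun x hx => (h₁.box hb x (hsub hx)).mono hl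
    · exact fun E F he => (h₁.ante_left hb (hsub he)).mono hl
    · exact fun E F he => (h₁.ante_right hb (hsub he)).mono hl
    · exact (h₂ _ hb).mono hl

/-- The step of the algorithm on `⋀ X → C` with `X` a set of implications, for either bracket. -/
theorem CtxPres.imps_step (hs : ∀ b, (s b).IsAtomOrBox) {σ : List (Form β)}
    (hσ : ∀ x ∈ σ, x.IsAtomOrBox) (h : Stable s true {x | x ∈ σ} (B.imp C))
    (hX : IsConj (imps X) B) {g : Form β × Form β → Form β} {P Z : Form β}
    (hg : ∀ D ∈ X, CtxPres s σ ((down X D).imp C) (g D))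
    (hZ : Entails s {bracketSet B (zSet X C)} Z) (hP : CtxPres s σ Z P) :
    CtxPres s σ (B.imp C) ((conj (X.image g)).and P) := by
  refine and_intro (conj_intro fun x hx => ?_) ?_
  · obtain ⟨D, hD, rfl⟩ := Finset.mem_image.1 hx
    exact (of_entails (.imp_intro (Entails.head.weaken.mp (Entails.head.of_down hX)))).trans
      (hg D hD)
  · have h₁ : CtxPres s σ (B.imp C) ((B.imp C).and B.box) :=
      of_entails (Entails.head.and_intro (h.box_of_imps hX).weaken)
    have h₂ : CtxPres s σ ((B.imp C).and B.box) (bracketSet B (zSet X C)) :=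
      of_pres hs hσ (Pres.bracketSet_subst hs hX)
    exact (h₁.trans h₂).trans ((of_entails (hZ.mono (by simp))).trans hP)

theorem NNILOut.ctxPres (hs : ∀ b, (s b).IsAtomOrBox) (h : NNILOut A Q) (hA : Over S A) :
    ∀ {σ : List (Form β)}, (∀ x ∈ σ, x.IsAtomOrBox) → Stable s true {x | x ∈ σ} A →
      CtxPres s σ A Q := by
  induction h with
  | atomOrBox | bot | top => exact fun _ _ => .of_entails .head
  | and _ _ h₁ h₂ =>
    intro σ hσ h
    cases h with
    | and h h' =>
      exact .and_intro (.trans (.of_entails Entails.head.left) (h₁ hA.1 hσ h))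
        (.trans (.of_entails Entails.head.right) (h₂ hA.2 hσ h'))
  | or _ _ h₁ h₂ =>
    intro σ hσ h
    cases h with
    | or h h' => exact .or_congr hs hσ (h₁ hA.1 hσ h) (h₂ hA.2 hσ h')
  | @impAnd B D E _ _ J _ _ h₁ h₂ =>
    intro σ hσ h
    cases h with
    | imp h h' =>
      have key : ∀ {F}, (∀ {Γ}, Stable s true Γ (D.and E) → Stable s true Γ F) →
          (∀ {Γ}, Entails s Γ ((D.and E).imp F)) →
          Stable s true {x | x ∈ σ} (B.imp (J.fill F)) ∧
            CtxPres s σ (B.imp (J.fill (D.and E))) (B.imp (J.fill F)) := fun hF hF' =>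
        ⟨.imp h fun b hb => (h' b hb).fill hF,
          .of_entails (.imp_intro (.fill_mono hF' (Entails.head.weaken.mp .head)))⟩
      obtain ⟨hD, hD'⟩ := key (F := D) (fun h => by cases h; assumption)
        (.imp_intro Entails.head.left)
      obtain ⟨hE, hE'⟩ := key (F := E) (fun h => by cases h; assumption)
        (.imp_intro Entails.head.right)
      exact .and_intro (hD'.trans (h₁ ⟨hA.1, over_fill_congr hA.2 And.left⟩ hσ hD))
        (hE'.trans (h₂ ⟨hA.1, over_fill_congr hA.2 And.right⟩ hσ hE))
  | @orImp C D E _ _ J _ _ h₁ h₂ =>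
    intro σ hσ h
    cases h with
    | imp h h' =>
      have key : ∀ {F}, (∀ b ∈ cases F, b ∈ cases (D.or E)) →
          (∀ {Γ}, Entails s Γ (F.imp (D.or E))) →
          Stable s true {x | x ∈ σ} ((J.fill F).imp C) ∧
            CtxPres s σ ((J.fill (D.or E)).imp C) ((J.fill F).imp C) := fun hF hF' =>
        ⟨.imp (h.ante_of_cases fun b hb => cases_fill hF hb) fun b hb => h' b (cases_fill hF hb),
          .of_entails (.imp_intro (Entails.head.weaken.mp (.fill_mono hF' .head)))⟩
      obtain ⟨hD, hD'⟩ := key (F := D) (fun b hb => .inl hb) (.imp_intro Entails.head.inl)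
      obtain ⟨hE, hE'⟩ := key (F := E) (fun b hb => .inr hb) (.imp_intro Entails.head.inr)
      exact .and_intro (hD'.trans (h₁ ⟨over_fill_congr hA.1 And.left, hA.2⟩ hσ hD))
        (hE'.trans (h₂ ⟨over_fill_congr hA.1 And.right, hA.2⟩ hσ hE))
  | @impAtom X _ B C p _ hX hXs _ _ hp hpa _ ih =>
    intro σ hσ h
    have hA' : Over S ((conj (X \ {p})).imp C) :=
      ⟨over_conj fun x hx => hX.over hA.1 x (Finset.mem_sdiff.1 hx).1, hA.2⟩
    refine .imp_intro (ih hA' (σ := p :: σ) (by simpa using ⟨hpa, hσ⟩) ?_) ?_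
    · refine (h.mono fun x hx => ?_).sdiff hX hXs fun x hx => ?_
      · exact List.mem_cons_of_mem _ hx
      · exact List.mem_cons.2 (.inl hx.1)
    · refine .imp_intro (.mp (.hyp (.inr (.inl rfl))) ((Entails.isConj_iff hX).2 fun x hx => ?_))
      by_cases hxp : x = p
      · exact .hyp (by simp [hxp])
      · exact Entails.head.conj_elim (by simp [hx, hxp])
  | @impTop X _ B C _ hX hXs _ _ _ _ ih =>
    intro σ hσ h
    have hA' : Over S ((conj (X \ {Form.top})).imp C) :=
      ⟨over_conj fun x hx => hX.over hA.1 x (Finset.mem_sdiff.1 hx).1, hA.2⟩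
    refine .trans (.of_entails ?_) (ih hA' hσ (h.sdiff hX hXs ?_))
    · refine .imp_intro (Entails.head.weaken.mp ((Entails.isConj_iff hX).2 fun x hx => ?_))
      by_cases hxp : x = Form.top
      · rw [hxp]; exact .top
      · exact Entails.head.conj_elim (by simp [hx, hxp])
    · rintro _ ⟨rfl, h⟩
      exact h.elim
  | impBot => exact fun _ _ => .of_entails .top
  | impImps g hX _ _ _ _ _ h₁ h₂ =>
    intro σ hσ h
    refine .imps_step hs hσ h hX
      (fun D hD => h₁ D hD ⟨over_down hX hA.1 hD, hA.2⟩ hσ (h.down_of_imps hX hD))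
      (.hyp rfl) (h₂ (over_bracketSet hX hA.1 hA.2) hσ (.disj fun x hx => ?_))
    obtain ⟨E, hE, rfl⟩ := Finset.mem_image.1 hx
    have hB := h
    cases hB with
    | imp hB _ => exact hB.bracket (h.zSet_of_imps hX E hE)
  | @impImps' X _ B C _ g hX _ _ _ _ _ h₁ h₂ =>
    intro σ hσ h
    refine .imps_step hs hσ h hX (Z := bracketSet' B (zSet X C))
      (fun D hD => h₁ D hD ⟨over_down hX hA.1 hD, hA.2⟩ hσ (h.down_of_imps hX hD))
      ?_ (h₂ (over_bracketSet' hX hA.1 hA.2) hσ (.disj fun x hx => ?_))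
    · refine Entails.disj_elim (.hyp rfl) fun x hx => ?_
      obtain ⟨E, hE, rfl⟩ := Finset.mem_image.1 hx
      exact .disj_intro (Entails.bracket'_of_bracket hA.1 .head) (Finset.mem_image_of_mem _ hE)
    · obtain ⟨E, hE, rfl⟩ := Finset.mem_image.1 hx
      have hB := h
      cases hB with
      | imp hB _ => exact hB.bracket' (h.zSet_of_imps hX E hE) hA.1

end

/-! ### Termination of the NNIL-algorithm -/

section

variable {S : Set β} {A B C D E F G Q : Form β}

theorem cMeasure_le_of_mem_outerImps (h : E ∈ outerImps A) : cMeasure E ≤ cMeasure A := by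
  induction A with
  | atom | bot | top | box => simp [outerImps] at h
  | and A B h₁ h₂ | or A B h₁ h₂ =>
    rw [outerImps, Finset.mem_union] at h
    rw [cMeasure]
    rcases h with h | h
    · have := h₁ h; omega
    · have := h₂ h; omega
  | imp A B h₁ h₂ =>
    simp only [outerImps, Finset.mem_union, Finset.mem_singleton] at h
    rcases h with (rfl | h) | h
    · rfl
    · have := h₁ h; rw [cMeasure]; omega
    · have := h₂ h; rw [cMeasure]; omega

theorem outerImps_subset_of_mem (h : E ∈ outerImps A) : outerImps E ⊆ outerImps A := by
  induction A with
  | atom | bot | top | box => simp [outerImps] at h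
  | and A B h₁ h₂ | or A B h₁ h₂ =>
    rw [outerImps, Finset.mem_union] at h
    rw [outerImps]
    rcases h with h | h
    · exact (h₁ h).trans Finset.subset_union_left
    · exact (h₂ h).trans Finset.subset_union_right
  | imp A B h₁ h₂ =>
    simp only [outerImps, Finset.mem_union, Finset.mem_singleton] at h
    rcases h with (rfl | h) | h
    · rfl
    · exact (h₁ h).trans (Finset.subset_union_right.trans Finset.subset_union_left)
    · exact (h₂ h).trans Finset.subset_union_right

theorem over_of_mem_outerImps (h : E ∈ outerImps A) (hA : Over S A) : Over S E := by
  induction A with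
  | atom | bot | top | box => simp [outerImps] at h
  | and A B h₁ h₂ | or A B h₁ h₂ =>
    rw [outerImps, Finset.mem_union] at h
    exact h.elim (h₁ · hA.1) (h₂ · hA.2)
  | imp A B h₁ h₂ =>
    simp only [outerImps, Finset.mem_union, Finset.mem_singleton] at h
    rcases h with (rfl | h) | h
    exacts [hA, h₁ h hA.1, h₂ h hA.2]

theorem outerImps_imp : outerImps (B.imp C) = insert (B.imp C) (outerImps B ∪ outerImps C) := by
  rw [outerImps, Finset.union_assoc, Finset.insert_eq]

theorem iMeasure_mono (h : outerImps A ⊆ outerImps B) : iMeasure A ≤ iMeasure B :=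
  Finset.sup_mono h

/-- The maximum is attained at the implication itself, whose set of outer implications contains
those of its subformulas. The extra `1` is `B → C`, which has too many connectives to occur in `B`
or `C`. -/
theorem iMeasure_imp : iMeasure (B.imp C) = (outerImps B ∪ outerImps C).card + 1 := by
  have h : iMeasure (B.imp C) = (outerImps (B.imp C)).card := by
    refine le_antisymm (Finset.sup_le fun E hE => ?_)
      (Finset.le_sup (f := fun E => (outerImps E).card) (by simp [outerImps]))
    exact Finset.card_le_card (outerImps_subset_of_mem hE)
  rw [h, outerImps_imp, Finset.card_insert_of_notMem]
  intro h
  have hc : cMeasure (B.imp C) = cMeasure B + cMeasure C + 1 := rfl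
  rcases Finset.mem_union.1 h with h | h <;>
  · have := cMeasure_le_of_mem_outerImps h
    omega

theorem iMeasure_imp_mono {B' C' : Form β} (hB : outerImps B' ⊆ outerImps B)
    (hC : outerImps C' ⊆ outerImps C) : iMeasure (B'.imp C') ≤ iMeasure (B.imp C) := by
  rw [iMeasure_imp, iMeasure_imp]
  exact Nat.succ_le_succ (Finset.card_le_card (Finset.union_subset_union hB hC))

theorem measureLT_wf : WellFounded (MeasureLT (α := β)) := by
  refine Subrelation.wf (r := InvImage (Prod.Lex (· < ·) (Prod.Lex (· < ·) (· < ·)))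
    fun A : Form β => (dMeasure A, iMeasure A, cMeasure A)) ?_
    (InvImage.wf _ (WellFounded.prod_lex wellFounded_lt
      (WellFounded.prod_lex wellFounded_lt wellFounded_lt)))
  intro A B h
  simpa [InvImage, Prod.lex_def, MeasureLT] using h

theorem Over.measureLT_iff (hA : Over S A) (hB : Over S B) : MeasureLT A B ↔
    iMeasure A < iMeasure B ∨ (iMeasure A = iMeasure B ∧ cMeasure A < cMeasure B) := by
  simp [MeasureLT, hA.dMeasure_eq, hB.dMeasure_eq]

theorem Over.measureLT (hA : Over S A) (hB : Over S B) (hi : iMeasure A ≤ iMeasure B)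
    (hc : cMeasure A < cMeasure B) : MeasureLT A B :=
  (hA.measureLT_iff hB).2 (hi.lt_or_eq.imp id fun h => ⟨h, hc⟩)

theorem outerImps_fill_subset {J : OuterCtx β} (h : outerImps D ⊆ outerImps E) :
    outerImps (J.fill D) ⊆ outerImps (J.fill E) := by
  induction J with
  | hole => exact h
  | andL J A ih | orL J A ih => exact Finset.union_subset_union_left ih
  | andR A J ih | orR A J ih => exact Finset.union_subset_union_right ih

theorem cMeasure_fill_lt {J : OuterCtx β} (h : cMeasure D < cMeasure E) :
    cMeasure (J.fill D) < cMeasure (J.fill E) := by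
  induction J with
  | hole => exact h
  | andL | andR | orL | orR => simp only [OuterCtx.fill, cMeasure]; omega

theorem IsConj.outerImps_subset {X : Finset (Form β)} (h : IsConj X B) {x : Form β}
    (hx : x ∈ X) : outerImps x ⊆ outerImps B := by
  induction h with
  | empty => simp at hx
  | single A => rw [Finset.mem_singleton.1 hx]
  | and _ _ h₁ h₂ =>
    rcases Finset.mem_union.1 hx with hx | hx
    · exact (h₁ hx).trans Finset.subset_union_left
    · exact (h₂ hx).trans Finset.subset_union_right

/-- Adding one to each conjunct accounts for the conjunction signs, of which there is one fewer than
conjuncts; repetitions can only increase the right-hand side. -/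
theorem IsConj.sum_le {X : Finset (Form β)} (h : IsConj X B) :
    ∑ x ∈ X, (cMeasure x + 1) ≤ cMeasure B + 1 := by
  induction h with
  | empty => simp
  | single A => simp
  | @and X Y _ _ _ _ h₁ h₂ =>
    have : ∑ x ∈ X ∪ Y, (cMeasure x + 1) ≤
        ∑ x ∈ X, (cMeasure x + 1) + ∑ x ∈ Y, (cMeasure x + 1) := by
      rw [← Finset.sum_union_inter]
      exact Nat.le_add_right _ _
    rw [cMeasure]
    omega

theorem outerImps_listConj_subset {U : Finset (Form β)} : ∀ {l : List (Form β)},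
    (∀ x ∈ l, outerImps x ⊆ U) → outerImps (listConj l) ⊆ U
  | [], _ => by simp [listConj, outerImps]
  | [A], h => h A (by simp)
  | _ :: _ :: _, h => Finset.union_subset (h _ (by simp))
      (outerImps_listConj_subset fun x hx => h x (by simp_all))

theorem outerImps_conj_subset {U X : Finset (Form β)} (h : ∀ x ∈ X, outerImps x ⊆ U) :
    outerImps (conj X) ⊆ U :=
  outerImps_listConj_subset (by simpa using h)

theorem exists_of_mem_outerImps_listDisj : ∀ {l : List (Form β)}, E ∈ outerImps (listDisj l) →
    ∃ x ∈ l, E ∈ outerImps x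
  | [], h => by simp [listDisj, outerImps] at h
  | [A], h => ⟨A, by simp, h⟩
  | A :: B :: l, h => by
    rcases Finset.mem_union.1 h with h | h
    · exact ⟨A, by simp, h⟩
    · obtain ⟨x, hx, h⟩ := exists_of_mem_outerImps_listDisj h
      exact ⟨x, List.mem_cons_of_mem _ hx, h⟩

theorem exists_of_mem_outerImps_disj {X : Finset (Form β)} (h : E ∈ outerImps (disj X)) :
    ∃ x ∈ X, E ∈ outerImps x := by
  simpa using exists_of_mem_outerImps_listDisj h

theorem cMeasure_listConj : ∀ {l : List (Form β)}, l ≠ [] →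
    cMeasure (listConj l) + 1 = (l.map fun x => cMeasure x + 1).sum
  | [_], _ => by simp [listConj]
  | A :: B :: l, _ => by
    have := cMeasure_listConj (l := B :: l) (by simp)
    rw [List.map_cons, List.sum_cons, ← this, listConj, cMeasure]
    omega

theorem cMeasure_conj {X : Finset (Form β)} (h : X.Nonempty) :
    cMeasure (conj X) + 1 = ∑ x ∈ X, (cMeasure x + 1) := by
  rw [conj, cMeasure_listConj (by simpa using h.ne_empty), Finset.sum_map_toList]

theorem conj_empty : conj (∅ : Finset (Form β)) = top := by simp [conj, listConj]

theorem replace_of_notMem (hA : Over S A) (h : E.imp F ∉ outerImps A) :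
    replace (E.imp F) G A = A := by
  induction A with
  | atom | bot | top => simp
  | box => exact hA.elim
  | and A B h₁ h₂ =>
    rw [outerImps, Finset.mem_union, not_or] at h
    rw [replace_and, h₁ hA.1 h.1, h₂ hA.2 h.2]
  | or A B h₁ h₂ =>
    rw [outerImps, Finset.mem_union, not_or] at h
    rw [replace_or, h₁ hA.1 h.1, h₂ hA.2 h.2]
  | imp A B h₁ h₂ =>
    simp only [outerImps, Finset.mem_union, Finset.mem_singleton, not_or] at h
    rw [replace_imp_of_ne (Ne.symm h.1.1), h₁ hA.1 h.1.2, h₂ hA.2 h.2]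

/-- An implication in the result either is the image of an implication other than `E → F`, or lies
inside an inserted copy of `F`. -/
theorem outerImps_replace_subset (hA : Over S A) : outerImps (replace (E.imp F) F A) ⊆
    (outerImps A \ {E.imp F}).image (replace (E.imp F) F) ∪ outerImps F := by
  induction A with
  | atom | bot | top => simp [outerImps]
  | box => exact hA.elim
  | and A B h₁ h₂ =>
    rw [replace_and, outerImps, outerImps, Finset.union_sdiff_distrib, Finset.image_union]
    exact Finset.union_subset ((h₁ hA.1).trans (by grind)) ((h₂ hA.2).trans (by grind))
  | or A B h₁ h₂ =>
    rw [replace_or, outerImps, outerImps, Finset.union_sdiff_distrib, Finset.image_union]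
    exact Finset.union_subset ((h₁ hA.1).trans (by grind)) ((h₂ hA.2).trans (by grind))
  | imp A B h₁ h₂ =>
    by_cases he : A.imp B = E.imp F
    · rw [he, replace_self]
      exact Finset.subset_union_right
    · have hr := replace_imp_of_ne (C := F) he
      rw [hr, outerImps, outerImps, ← hr, Finset.union_sdiff_distrib, Finset.image_union,
        Finset.union_sdiff_distrib, Finset.image_union]
      refine Finset.union_subset (Finset.union_subset ?_ ((h₁ hA.1).trans (by grind)))
        ((h₂ hA.2).trans (by grind))
      rw [Finset.singleton_subset_iff]
      refine Finset.mem_union_left _ (Finset.mem_union_left _ (Finset.mem_union_left _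
        (Finset.mem_image_of_mem _ ?_)))
      simpa using he

/-- Replacing an implication of `U` by its succedent removes an implication. -/
theorem card_outerImps_replace_lt (hB : Over S B) (hEF : Over S (E.imp F))
    {U : Finset (Form β)} (hBU : outerImps B ⊆ U) (hU : outerImps (E.imp F) ⊆ U) :
    (outerImps ((replace (E.imp F) F B).and E) ∪ outerImps F).card < U.card := by
  have hmem : E.imp F ∈ U := hU (by simp [outerImps])
  -- By connective count, no implication inside `E` or `F` contains `E → F`. The replacement
  -- therefore fixes it, and it is its own preimage.
  have hself : ∀ G, G ∈ outerImps E ∪ outerImps F →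
      G ∈ (U \ {E.imp F}).image (replace (E.imp F) F) := by
    intro G hG
    have hc : cMeasure G < cMeasure (E.imp F) := by
      rw [cMeasure]
      rcases Finset.mem_union.1 hG with hG | hG <;>
      · have := cMeasure_le_of_mem_outerImps hG
        omega
    have hGo : Over S G := by
      rcases Finset.mem_union.1 hG with hG | hG
      exacts [over_of_mem_outerImps hG hEF.1, over_of_mem_outerImps hG hEF.2]
    refine Finset.mem_image.2 ⟨G, ?_, replace_of_notMem hGo fun h => ?_⟩
    · rw [Finset.mem_sdiff, Finset.mem_singleton]
      refine ⟨hU ?_, fun h => by simp [h] at hc⟩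
      rw [outerImps, Finset.union_assoc]
      exact Finset.mem_union_right _ hG
    · exact absurd (cMeasure_le_of_mem_outerImps h) (by omega)
  have hsub : outerImps ((replace (E.imp F) F B).and E) ∪ outerImps F ⊆
      (U \ {E.imp F}).image (replace (E.imp F) F) := by
    refine Finset.union_subset (Finset.union_subset ?_ ?_) ?_
    · refine (outerImps_replace_subset hB).trans (Finset.union_subset
        (Finset.image_subset_image (Finset.sdiff_subset_sdiff hBU le_rfl)) ?_)
      exact fun G hG => hself G (Finset.mem_union_right _ hG)
    · exact fun G hG => hself G (Finset.mem_union_left _ hG)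
    · exact fun G hG => hself G (Finset.mem_union_right _ hG)
  refine (Finset.card_le_card hsub).trans_lt (Finset.card_image_le.trans_lt ?_)
  exact Finset.card_lt_card ⟨Finset.sdiff_subset, fun h => by simpa using h hmem⟩

theorem exists_of_mem_outerImps_bracket' (h : G ∈ outerImps (bracket' B A)) :
    ∃ E F, E.imp F ∈ outerImps A ∧
      outerImps G ⊆ outerImps (((replace (E.imp F) F B).and E).imp F) := by
  induction A with
  | atom | bot | top | box => simp [bracket', outerImps] at h
  | and A₁ A₂ h₁ h₂ | or A₁ A₂ h₁ h₂ =>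
    rcases Finset.mem_union.1 h with h | h
    · obtain ⟨E, F, hE, h⟩ := h₁ h
      exact ⟨E, F, Finset.mem_union_left _ hE, h⟩
    · obtain ⟨E, F, hE, h⟩ := h₂ h
      exact ⟨E, F, Finset.mem_union_right _ hE, h⟩
  | imp E F => exact ⟨E, F, by simp [outerImps], outerImps_subset_of_mem h⟩

variable {X : Finset (Form β × Form β)}

/-- Each implication created by `[B]'` lies inside some `(B' ∧ E) → F` with `E → F` among the old
implications. Merging `E → F` into `F` loses one of them, which makes room for the new outermost
implication, and the old measure also counted `B → C`. -/
theorem iMeasure_bracketSet'_lt (hX : IsConj (imps X) B) (hB : Over S B) (hC : Over S C) :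
    iMeasure (bracketSet' B (zSet X C)) < iMeasure (B.imp C) := by
  rw [iMeasure, iMeasure_imp, Finset.sup_lt_iff (by simp)]
  intro G hG
  obtain ⟨x, hx, hG⟩ := exists_of_mem_outerImps_disj hG
  obtain ⟨A, hA, rfl⟩ := Finset.mem_image.1 hx
  obtain ⟨E, F, hEF, h⟩ := exists_of_mem_outerImps_bracket' hG
  have hEFo := over_of_mem_outerImps hEF (over_zSet hX hB hC A hA)
  have hAU : outerImps A ⊆ outerImps B ∪ outerImps C := by
    obtain rfl | ⟨A', h⟩ := mem_zSet.1 hA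
    · exact Finset.subset_union_right
    · refine (Finset.Subset.trans ?_ (hX.outerImps_subset (mem_imps.2 h))).trans
        Finset.subset_union_left
      exact Finset.subset_union_right.trans Finset.subset_union_left
  refine (Finset.card_le_card h).trans_lt (Nat.lt_succ_of_le ?_)
  have hle : (outerImps (((replace (E.imp F) F B).and E).imp F)).card ≤
      (outerImps ((replace (E.imp F) F B).and E) ∪ outerImps F).card + 1 := by
    rw [outerImps_imp]
    exact Finset.card_insert_le _ _
  exact hle.trans (card_outerImps_replace_lt hB hEFo Finset.subset_union_left
    ((outerImps_subset_of_mem hEF).trans hAU))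

theorem measureLT_down (hX : IsConj (imps X) B) (hB : Over S B) (hC : Over S C)
    {D : Form β × Form β} (hD : D ∈ X) : MeasureLT ((down X D).imp C) (B.imp C) := by
  have hDX : toImp D ∈ imps X := mem_imps.2 hD
  refine Over.measureLT ⟨over_down hX hB hD, hC⟩ ⟨hB, hC⟩ (iMeasure_imp_mono ?_ le_rfl) ?_
  · refine outerImps_conj_subset fun x hx => ?_
    obtain rfl | hx := mem_down hx
    · exact Finset.subset_union_right.trans (hX.outerImps_subset hDX)
    · exact hX.outerImps_subset hx
  · have h₁ := cMeasure_conj (X := (imps X \ {toImp D}) ∪ {D.2}) ⟨D.2, by simp⟩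
    have h₂ : ∑ x ∈ (imps X \ {toImp D}) ∪ {D.2}, (cMeasure x + 1) ≤
        ∑ x ∈ imps X \ {toImp D}, (cMeasure x + 1) + (cMeasure D.2 + 1) := by
      rw [← Finset.sum_singleton (fun x => cMeasure x + 1) D.2, ← Finset.sum_union_inter]
      exact Nat.le_add_right _ _
    have h₃ : ∑ x ∈ imps X \ {toImp D}, (cMeasure x + 1) + (cMeasure (toImp D) + 1) =
        ∑ x ∈ imps X, (cMeasure x + 1) := by
      rw [← Finset.sum_sdiff (Finset.singleton_subset_iff.2 hDX), Finset.sum_singleton]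
    have h₄ := hX.sum_le
    have h₅ : cMeasure (toImp D) = cMeasure D.1 + cMeasure D.2 + 1 := rfl
    simp only [cMeasure, down]
    omega

/-- This is kept apart from the main induction so that it also applies to `⊤ → C`, which may be no
smaller than the formula it came from. -/
theorem exists_nnilOut_of_imps {Y : Finset (Form β)} (hX : IsConj (imps X) B)
    (hY : IsDisj Y C) (hYs : ∀ E ∈ Y, E.IsSimple) (hB : Over S B) (hC : Over S C)
    (ih : ∀ A, MeasureLT A (B.imp C) → Over S A → ∃ Q, NNILOut A Q) :
    ∃ Q, NNILOut (B.imp C) Q := by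
  have hg : ∀ D, ∃ Q, D ∈ X → NNILOut ((down X D).imp C) Q := fun D => by
    by_cases hD : D ∈ X
    · obtain ⟨Q, hQ⟩ := ih _ (measureLT_down hX hB hC hD) ⟨over_down hX hB hD, hC⟩
      exact ⟨Q, fun _ => hQ⟩
    -- Values of `g` outside `X` are never used.
    · exact ⟨top, fun h => (hD h).elim⟩
  choose g hg using hg
  by_cases hlt : MeasureLT (bracketSet B (zSet X C)) (B.imp C)
  · obtain ⟨P, hP⟩ := ih _ hlt (over_bracketSet hX hB hC)
    exact ⟨_, .impImps g hX hY hYs hlt hg hP⟩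
  · have ho := over_bracketSet' hX hB hC
    obtain ⟨P, hP⟩ := ih _ ((ho.measureLT_iff (B := B.imp C) ⟨hB, hC⟩).2
      (.inl (iMeasure_bracketSet'_lt hX hB hC))) ho
    exact ⟨_, .impImps' g hX hY hYs hlt hg hP⟩

/-- Each conjunct `top` is read as the empty conjunction. Removing `top` from `{top}` would give `⊤
→ C` back, so the rule for `top` is avoided altogether. -/
theorem exists_isConj (h : ∀ (J : OuterCtx β) D E, B ≠ J.fill (or D E)) :
    ∃ X, IsConj X B ∧ (∀ x ∈ X, x.IsSimple) ∧ top ∉ X := by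
  induction B with
  | top => exact ⟨∅, .empty, by simp, by simp⟩
  | atom | bot | imp | box =>
    exact ⟨_, .single _, by simp [IsSimple], by simp⟩
  | or D E => exact (h .hole D E rfl).elim
  | and B C h₁ h₂ =>
    obtain ⟨X, hX, hXs, hXt⟩ := h₁ fun J D E he => h (.andL J C) D E (by rw [he]; rfl)
    obtain ⟨Y, hY, hYs, hYt⟩ := h₂ fun J D E he => h (.andR B J) D E (by rw [he]; rfl)
    refine ⟨_, .and hX hY, fun x hx => (Finset.mem_union.1 hx).elim (hXs x) (hYs x), ?_⟩
    simp [hXt, hYt]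

theorem exists_isDisj (h : ∀ (J : OuterCtx β) D E, C ≠ J.fill (and D E)) :
    ∃ Y, IsDisj Y C ∧ ∀ x ∈ Y, x.IsSimple := by
  induction C with
  | atom | bot | top | imp | box => exact ⟨_, .single _, by simp [IsSimple]⟩
  | and D E => exact (h .hole D E rfl).elim
  | or B C h₁ h₂ =>
    obtain ⟨X, hX, hXs⟩ := h₁ fun J D E he => h (.orL J C) D E (by rw [he]; rfl)
    obtain ⟨Y, hY, hYs⟩ := h₂ fun J D E he => h (.orR B J) D E (by rw [he]; rfl)
    exact ⟨_, .or hX hY, fun x hx => (Finset.mem_union.1 hx).elim (hXs x) (hYs x)⟩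

theorem exists_imps {X : Finset (Form β)} (h : ∀ x ∈ X, ∃ E F, x = imp E F) :
    ∃ X', X = imps X' := by
  induction X using Finset.induction_on with
  | empty => exact ⟨∅, by simp [imps]⟩
  | insert x X _ ih =>
    obtain ⟨X', rfl⟩ := ih fun y hy => h y (Finset.mem_insert_of_mem hy)
    obtain ⟨E, F, rfl⟩ := h x (Finset.mem_insert_self _ _)
    exact ⟨insert (E, F) X', by simp [imps, toImp]⟩

theorem exists_nnilOut (hA : Over S A) : ∃ Q, NNILOut A Q := by
  induction A using measureLT_wf.induction with
  | _ A ih =>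
  cases A with
  | atom a => exact ⟨_, .atomOrBox trivial⟩
  | bot => exact ⟨_, .bot⟩
  | top => exact ⟨_, .top⟩
  | box => exact hA.elim
  | and B C =>
    obtain ⟨P, hP⟩ := ih B (hA.1.measureLT hA (iMeasure_mono Finset.subset_union_left)
      (by simp only [cMeasure]; omega)) hA.1
    obtain ⟨Q, hQ⟩ := ih C (hA.2.measureLT hA (iMeasure_mono Finset.subset_union_right)
      (by simp only [cMeasure]; omega)) hA.2
    exact ⟨_, .and hP hQ⟩
  | or B C =>
    obtain ⟨P, hP⟩ := ih B (hA.1.measureLT hA (iMeasure_mono Finset.subset_union_left)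
      (by simp only [cMeasure]; omega)) hA.1
    obtain ⟨Q, hQ⟩ := ih C (hA.2.measureLT hA (iMeasure_mono Finset.subset_union_right)
      (by simp only [cMeasure]; omega)) hA.2
    exact ⟨_, .or hP hQ⟩
  | imp B C =>
    by_cases hC : ∀ (J : OuterCtx β) D E, C ≠ J.fill (and D E)
    swap
    · push Not at hC
      obtain ⟨J, D, E, rfl⟩ := hC
      have key : ∀ F, (Over S (D.and E) → Over S F) → outerImps F ⊆ outerImps (D.and E) →
          cMeasure F < cMeasure (D.and E) → ∃ Q, NNILOut (B.imp (J.fill F)) Q := by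
        intro F hF hi hc
        have ho : Over S (B.imp (J.fill F)) := ⟨hA.1, over_fill_congr hA.2 hF⟩
        refine ih _ (ho.measureLT hA (iMeasure_imp_mono le_rfl (outerImps_fill_subset hi)) ?_) ho
        have := cMeasure_fill_lt (J := J) hc
        simp only [cMeasure] at this ⊢
        omega
      obtain ⟨P, hP⟩ := key D And.left Finset.subset_union_left (by simp only [cMeasure]; omega)
      obtain ⟨Q, hQ⟩ := key E And.right Finset.subset_union_right (by simp only [cMeasure]; omega)
      exact ⟨_, .impAnd J hP hQ⟩
    by_cases hB : ∀ (J : OuterCtx β) D E, B ≠ J.fill (or D E)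
    swap
    · push Not at hB
      obtain ⟨J, D, E, rfl⟩ := hB
      have key : ∀ F, (Over S (D.or E) → Over S F) → outerImps F ⊆ outerImps (D.or E) →
          cMeasure F < cMeasure (D.or E) → ∃ Q, NNILOut ((J.fill F).imp C) Q := by
        intro F hF hi hc
        have ho : Over S ((J.fill F).imp C) := ⟨over_fill_congr hA.1 hF, hA.2⟩
        refine ih _ (ho.measureLT hA (iMeasure_imp_mono (outerImps_fill_subset hi) le_rfl) ?_) ho
        have := cMeasure_fill_lt (J := J) hc
        simp only [cMeasure] at this ⊢
        omega
      obtain ⟨P, hP⟩ := key D And.left Finset.subset_union_left (by simp only [cMeasure]; omega)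
      obtain ⟨Q, hQ⟩ := key E And.right Finset.subset_union_right (by simp only [cMeasure]; omega)
      exact ⟨_, .orImp J hP hQ⟩
    obtain ⟨X, hX, hXs, hXt⟩ := exists_isConj hB
    obtain ⟨Y, hY, hYs⟩ := exists_isDisj hC
    have hXo := hX.over hA.1
    by_cases hbot : bot ∈ X
    · exact ⟨_, .impBot hX hXs hY hYs hbot⟩
    by_cases hatom : ∃ a, atom a ∈ X
    · obtain ⟨a, ha⟩ := hatom
      have hi : outerImps (conj (X \ {atom a})) ⊆ outerImps B :=
        outerImps_conj_subset fun x hx => hX.outerImps_subset (Finset.mem_sdiff.1 hx).1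
      have ho : Over S ((conj (X \ {atom a})).imp C) :=
        ⟨over_conj fun x hx => hXo x (Finset.mem_sdiff.1 hx).1, hA.2⟩
      suffices ∃ Q, NNILOut ((conj (X \ {atom a})).imp C) Q from
        this.imp' _ fun Q hQ => .impAtom hX hXs hY hYs ha trivial hQ
      -- If `atom a` was the only conjunct, what remains is `⊤ → C`, whose measure need not have
      -- dropped. One further step, on the empty set of implications, reaches formulas that are
      -- smaller.
      rcases (X \ {atom a}).eq_empty_or_nonempty with he | hne
      · rw [he, conj_empty] at ho hi ⊢
        refine exists_nnilOut_of_imps (X := ∅) (by simpa [imps] using IsConj.empty) hY hYs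
          ho.1 ho.2 fun A' hA' hA'o => ih A' ?_ hA'o
        rw [hA'o.measureLT_iff ho] at hA'
        rw [hA'o.measureLT_iff hA]
        have h₁ := iMeasure_imp_mono hi (le_refl (outerImps C))
        have h₂ : cMeasure (top.imp C) ≤ cMeasure (B.imp C) := by simp [cMeasure]
        omega
      · refine ih _ (ho.measureLT hA (iMeasure_imp_mono hi le_rfl) ?_) ho
        have h₁ := cMeasure_conj hne
        have h₂ := hX.sum_le
        rw [← Finset.sum_sdiff (Finset.singleton_subset_iff.2 ha), Finset.sum_singleton] at h₂
        simp only [cMeasure] at h₁ h₂ ⊢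
        omega
    · have himp : ∀ x ∈ X, ∃ E F, x = imp E F := by
        intro x hx
        cases x with
        | imp E F => exact ⟨E, F, rfl⟩
        | atom a => exact (hatom ⟨a, hx⟩).elim
        | bot => exact (hbot hx).elim
        | top => exact (hXt hx).elim
        | box => exact (hXo _ hx).elim
        | and | or => exact (hXs _ hx).elim
      obtain ⟨X', rfl⟩ := exists_imps himp
      exact exists_nnilOut_of_imps hX hY hYs hA.1 hA.2 ih

end

/-! ### The box translation is stable -/

/-- The substitution that turns the skeleton of a formula back into the formula. -/
def unskeleton : α ⊕ Form α → Form α := Sum.elim atom box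

theorem isAtomOrBox_unskeleton (b : α ⊕ Form α) : (unskeleton b).IsAtomOrBox := by
  cases b <;> trivial

@[simp] theorem skeleton_subst (A : Form α) : A.skeleton.subst unskeleton = A := by
  induction A <;> simp_all [skeleton, subst, unskeleton]

theorem over_skeleton {T : Set (Form α)} {A : Form α} (h : outerBoxes A ⊆ T) :
    Over {x | ∀ B, x = .inr B → B ∈ T} A.skeleton := by
  induction A with
  | atom a => intro B hB; cases hB
  | bot | top => trivial
  | and A B h₁ h₂ | or A B h₁ h₂ | imp A B h₁ h₂ =>
    exact ⟨h₁ (Set.subset_union_left.trans h), h₂ (Set.subset_union_right.trans h)⟩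
  | box B =>
    rintro _ ⟨⟩
    exact h rfl

theorem entails_box_inr {Γ : Set (Form (α ⊕ Form α))} {A : Form α} {B : Form (α ⊕ Form α)}
    (h : atom (.inr A) ∈ Γ) (hB : B.subst unskeleton = A) : Entails unskeleton Γ B.box := by
  subst hB
  have h' : IK4 ((B.subst unskeleton).box.imp (B.subst unskeleton).box) :=
    (Entails.imp_self (s := unskeleton) (A := B.box)).ik4
  exact .mp (A := atom (Sum.inr (B.subst unskeleton))) (.thm (s := unskeleton) h') (.hyp h)

theorem entails_box_atom_inr {Γ : Set (Form (α ⊕ Form α))} {A : Form α}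
    (h : atom (.inr A) ∈ Γ) : Entails unskeleton Γ (atom (.inr A)).box :=
  have h' : IK4 (((atom (Sum.inr A)).imp (atom (Sum.inr A)).box).subst unskeleton) := .four A
  (Entails.thm h').mp (.hyp h)

/-- A variable `□D` in a case proves `□D` as the boxing of `D`, and `□□D` by transitivity; every
atom and implication in a case has such a companion. The three claims are proved together because an
implication uses its antecedent and its succedent in both polarities. -/
theorem stable_boxTrans_aux (A : Form α) :
    (∀ Γ, Stable unskeleton true Γ A.boxTrans.skeleton) ∧
    (∀ b ∈ cases A.boxTrans.skeleton, ∀ x ∈ b, Entails unskeleton (lits b) x.box) ∧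
    ∀ b ∈ cases A.boxTrans.skeleton, ∀ E F, imp E F ∈ b → ∀ Γ,
      Stable unskeleton true Γ E ∧ Stable unskeleton false Γ F := by
  have ante : ∀ {A : Form α},
      (∀ b ∈ cases A.boxTrans.skeleton, ∀ x ∈ b, Entails unskeleton (lits b) x.box) →
      (∀ b ∈ cases A.boxTrans.skeleton, ∀ E F, imp E F ∈ b → ∀ Γ,
        Stable unskeleton true Γ E ∧ Stable unskeleton false Γ F) →
      ∀ Γ, Stable unskeleton false Γ A.boxTrans.skeleton := fun h₁ h₂ Γ =>
    .ante (fun b hb x hx => (h₁ b hb x hx).mono Set.subset_union_right)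
      (fun b hb E F he => (h₂ b hb E F he _).1) fun b hb E F he => (h₂ b hb E F he _).2
  induction A with
  | atom a =>
    refine ⟨fun Γ => .and (.atom _) (.atom _), ?_, ?_⟩
    · rintro _ ⟨_, rfl, _, rfl, rfl⟩ x hx
      have hm : atom (.inr (atom a)) ∈
          lits ({atom (.inl a)} ∪ {atom (.inr (atom a))} : Set (Form (α ⊕ Form α))) :=
        ⟨.inr rfl, trivial⟩
      rcases hx with rfl | rfl
      · exact entails_box_inr hm rfl
      · exact entails_box_atom_inr hm
    · rintro _ ⟨_, rfl, _, rfl, rfl⟩ E F (h | h) <;> cases h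
  | bot =>
    refine ⟨fun Γ => .bot, ?_, ?_⟩
    · rintro _ rfl _ rfl
      -- Since `bot` counts as a literal, it is available here and proves its own box.
      exact Entails.bot_elim (.hyp ⟨rfl, trivial⟩)
    · rintro _ rfl E F h
      cases h
  | top =>
    refine ⟨fun Γ => .top, ?_, ?_⟩
    · rintro _ rfl _ ⟨⟩
    · rintro _ rfl E F ⟨⟩
  | box A =>
    refine ⟨fun Γ => .atom _, ?_, ?_⟩
    · rintro _ rfl _ rfl
      exact entails_box_atom_inr ⟨rfl, trivial⟩
    · rintro _ rfl E F h
      cases h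
  | and A B hA hB =>
    refine ⟨fun Γ => .and (hA.1 Γ) (hB.1 Γ), ?_, ?_⟩
    · rintro _ ⟨a, ha, b, hb, rfl⟩ x (hx | hx)
      · exact (hA.2.1 a ha x hx).mono (lits_mono Set.subset_union_left)
      · exact (hB.2.1 b hb x hx).mono (lits_mono Set.subset_union_right)
    · rintro _ ⟨a, ha, b, hb, rfl⟩ E F (hx | hx)
      exacts [hA.2.2 a ha E F hx, hB.2.2 b hb E F hx]
  | or A B hA hB =>
    refine ⟨fun Γ => .or (hA.1 Γ) (hB.1 Γ), ?_, ?_⟩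
    · rintro b (hb | hb)
      exacts [hA.2.1 b hb, hB.2.1 b hb]
    · rintro b (hb | hb)
      exacts [hA.2.2 b hb, hB.2.2 b hb]
  | imp A B hA hB =>
    refine ⟨fun Γ => .and (.imp (ante hA.2.1 hA.2.2 Γ) fun b _ => hB.1 _) (.atom _), ?_, ?_⟩
    · rintro _ ⟨_, rfl, _, rfl, rfl⟩ x hx
      have hm : atom (.inr (A.boxTrans.imp B.boxTrans)) ∈
          lits ({A.boxTrans.skeleton.imp B.boxTrans.skeleton} ∪
            {atom (.inr (A.boxTrans.imp B.boxTrans))} : Set (Form (α ⊕ Form α))) :=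
        ⟨.inr rfl, trivial⟩
      rcases hx with rfl | rfl
      · exact entails_box_inr hm (by simp [subst])
      · exact entails_box_atom_inr hm
    · rintro _ ⟨_, rfl, _, rfl, rfl⟩ E F (h | h) Γ <;> cases h
      exact ⟨hA.1 Γ, ante hB.2.1 hB.2.2 Γ⟩

theorem stable_boxTrans (A : Form α) (Γ : Set (Form (α ⊕ Form α))) :
    Stable unskeleton true Γ A.boxTrans.skeleton :=
  (stable_boxTrans_aux A).1 Γ

theorem stable_boxTrans_ante (A : Form α) (Γ : Set (Form (α ⊕ Form α))) :
    Stable unskeleton false Γ A.boxTrans.skeleton :=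
  .ante (fun b hb x hx => ((stable_boxTrans_aux A).2.1 b hb x hx).mono Set.subset_union_right)
    (fun b hb E F he => ((stable_boxTrans_aux A).2.2 b hb E F he _).1)
    fun b hb E F he => ((stable_boxTrans_aux A).2.2 b hb E F he _).2

/-- The formulas that occur in the box translation of a formula under a box: box translations,
implications between them, and variables. -/
inductive BoxTransLike : Form α → Prop
  | boxTrans (A : Form α) : BoxTransLike A.boxTrans
  | imp (A B : Form α) : BoxTransLike (A.boxTrans.imp B.boxTrans)
  | atom (a : α) : BoxTransLike (atom a)

theorem BoxTransLike.stable {A : Form α} (h : BoxTransLike A) :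
    Stable unskeleton true ∅ A.skeleton := by
  cases h with
  | boxTrans A => exact stable_boxTrans A _
  | imp A B => exact .imp (stable_boxTrans_ante A _) fun _ _ => stable_boxTrans B _
  | atom a => exact .atom _

theorem boxTransLike_of_mem_outerBoxes_boxTrans {A B : Form α} (h : B ∈ outerBoxes A.boxTrans) :
    BoxTransLike B := by
  induction A with
  | atom a =>
    rcases h with h | rfl
    exacts [h.elim, .atom a]
  | bot | top => exact h.elim
  | and A B h₁ h₂ | or A B h₁ h₂ => exact h.elim h₁ h₂
  | imp A B h₁ h₂ =>
    rcases h with (h | h) | rfl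
    exacts [h₁ h, h₂ h, .imp A B]
  | box A => rw [show B = A.boxTrans from h]; exact .boxTrans A

theorem BoxTransLike.of_mem_outerBoxes {A B : Form α} (hA : BoxTransLike A)
    (h : B ∈ outerBoxes A) : BoxTransLike B := by
  cases hA with
  | boxTrans A => exact boxTransLike_of_mem_outerBoxes_boxTrans h
  | imp A C =>
    exact h.elim boxTransLike_of_mem_outerBoxes_boxTrans
      boxTransLike_of_mem_outerBoxes_boxTrans
  | atom => exact h.elim

/-! ### The TNNIL-algorithm -/

theorem dMeasure_lt_of_mem_outerBoxes {A B : Form α} (h : B ∈ outerBoxes A) :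
    dMeasure B < dMeasure A := by
  induction A with
  | atom | bot | top => exact h.elim
  | and A B h₁ h₂ | or A B h₁ h₂ | imp A B h₁ h₂ =>
    rw [dMeasure, lt_max_iff]
    exact h.imp h₁ h₂
  | box A => rw [show B = A from h, dMeasure]; omega

theorem exists_tnnilOut (A : Form α) : ∃ P, TNNILOut A P := by
  induction hn : dMeasure A using Nat.strong_induction_on generalizing A with
  | _ n ih =>
  have hf : ∀ B, ∃ P, B ∈ outerBoxes A → TNNILOut B P := fun B => by
    by_cases hB : B ∈ outerBoxes A
    · obtain ⟨P, hP⟩ := ih _ (hn ▸ dMeasure_lt_of_mem_outerBoxes hB) B rfl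
      exact ⟨P, fun _ => hP⟩
    · exact ⟨top, fun h => (hB h).elim⟩
  choose f hf using hf
  obtain ⟨Q, hQ⟩ := exists_nnilOut (over_skeleton (subset_refl (outerBoxes A)))
  exact ⟨_, .mk f hQ hf⟩

theorem Pres.imp_elim {A B : Form α} (h : Pres top (A.imp B)) : Pres A B := by
  have e := subst_atom (α := α)
  have h₁ : Pres A top := .A1 (by simpa [e] using Entails.ik4_imp (s := atom) (A := A) .top)
  have h₂ : Pres A A := .A1 (by simpa [e] using Entails.ik4_imp (s := atom) (A := A) .single)
  refine .A2 (.A3 (.A2 h₁ h) h₂) (.A1 ?_)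
  have h₃ : Entails atom {(A.imp B).and A} B := Entails.single.left.mp Entails.single.right
  simpa [e] using h₃.ik4_imp

/-- A formula that follows in `iK4` from a list of formulas preserved from `top` is itself
preserved from `top`. -/
theorem Pres.top_of_entails {Γ : Set (Form α)} {A : Form α} (h : Entails atom Γ A)
    (hΓ : ∀ x ∈ Γ, Pres top x) : Pres top A := by
  induction h with
  | thm h =>
    rw [subst_atom] at h
    exact .A1 (.mp (.ipc (.k _ _)) h)
  | hyp h => exact hΓ _ h
  | mp _ _ h₁ h₂ => exact .A2 h₂ h₁.imp_elim

/-- Preservativity itself is not a congruence for implication, so the induction runs on the stronger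
statement that both implications are preserved from `top`. -/
theorem PresEquiv.subst_box {f : Form α → Form α} {T : Set (Form α)}
    (hf : ∀ B ∈ T, PresEquiv B (f B)) {Q : Form (α ⊕ Form α)}
    (hQ : Over {x | ∀ B, x = .inr B → B ∈ T} Q) :
    PresEquiv (Q.subst unskeleton) (Q.subst (Sum.elim atom fun B => (f B).box)) := by
  have top_box : ∀ {A B : Form α}, Pres A B → Pres top (A.box.imp B.box) := fun h =>
    .A2 (Pres.top_of_entails (Γ := ∅) .imp_self (by simp)) (.B3 trivial (.A4 h))
  suffices Pres top ((Q.subst unskeleton).imp (Q.subst (Sum.elim atom fun B => (f B).box))) ∧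
      Pres top ((Q.subst (Sum.elim atom fun B => (f B).box)).imp (Q.subst unskeleton)) from
    ⟨this.1.imp_elim, this.2.imp_elim⟩
  have self : ∀ A : Form α, Pres top (A.imp A) := fun A =>
    Pres.top_of_entails (Γ := ∅) .imp_self (by simp)
  have and_congr : ∀ {A B A' B' : Form α}, Pres top (A.imp A') → Pres top (B.imp B') →
      Pres top ((A.and B).imp (A'.and B')) := fun {A B A' B'} h h' =>
    Pres.top_of_entails (Γ := {A.imp A', B.imp B'})
      (.imp_intro ((Entails.mp (.hyp (by simp)) Entails.head.left).and_intro
        (.mp (.hyp (by simp)) Entails.head.right))) (by simp [h, h'])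
  have or_congr : ∀ {A B A' B' : Form α}, Pres top (A.imp A') → Pres top (B.imp B') →
      Pres top ((A.or B).imp (A'.or B')) := fun {A B A' B'} h h' =>
    Pres.top_of_entails (Γ := {A.imp A', B.imp B'})
      (.imp_intro (Entails.head.or_elim (Entails.mp (.hyp (by simp)) .head).inl
        (Entails.mp (.hyp (by simp)) .head).inr)) (by simp [h, h'])
  have imp_congr : ∀ {A B A' B' : Form α}, Pres top (A'.imp A) → Pres top (B.imp B') →
      Pres top ((A.imp B).imp (A'.imp B')) := fun {A B A' B'} h h' =>
    Pres.top_of_entails (Γ := {A'.imp A, B.imp B'})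
      (.imp_intro (.imp_intro (.mp (A := B) (.hyp (by simp))
        (.mp (A := A) (.hyp (by simp)) (.mp (A := A') (.hyp (by simp)) .head)))))
      (by simp [h, h'])
  induction Q with
  | atom x =>
    cases x with
    | inl a => exact ⟨self _, self _⟩
    | inr B =>
      have := hf B (hQ B rfl)
      exact ⟨top_box this.1, top_box this.2⟩
  | bot | top => exact ⟨self _, self _⟩
  | box => exact hQ.elim
  | and A B h₁ h₂ =>
    have h₁ := h₁ hQ.1
    have h₂ := h₂ hQ.2
    exact ⟨and_congr h₁.1 h₂.1, and_congr h₁.2 h₂.2⟩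
  | or A B h₁ h₂ =>
    have h₁ := h₁ hQ.1
    have h₂ := h₂ hQ.2
    exact ⟨or_congr h₁.1 h₂.1, or_congr h₁.2 h₂.2⟩
  | imp A B h₁ h₂ =>
    have h₁ := h₁ hQ.1
    have h₂ := h₂ hQ.2
    exact ⟨imp_congr h₁.2 h₂.1, imp_congr h₁.1 h₂.2⟩

theorem TNNILOut.presEquiv {A P : Form α} (h : TNNILOut A P) (hA : BoxTransLike A) :
    PresEquiv A P := by
  induction h with
  | @mk A Q f hQ _ ih =>
    have ho := over_skeleton (subset_refl (outerBoxes A))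
    -- The context starts empty: stability of the skeleton over `∅` is the entire hypothesis needed.
    have h₁ := hQ.ctxPres isAtomOrBox_unskeleton ho (σ := []) (by simp) (by simpa using hA.stable)
    have h₂ : Pres (Q.subst unskeleton) A :=
      .A1 (by simpa using (hQ.entails (s := unskeleton) ho Entails.single).ik4_imp)
    have h₃ := PresEquiv.subst_box (fun B hB => ih B hB (hA.of_mem_outerBoxes hB)) (hQ.over ho)
    simp only [CtxPres, ctxImp, List.foldr_nil, skeleton_subst] at h₁
    exact ⟨.A2 h₁ h₃.1, .A2 h₃.2 h₂⟩

end Form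

theorem mainTheorem5 {α : Type*} (A : Form α) :
    (∃ P : Form α, Form.TNNILOut A.boxTrans P) ∧
      ∀ P : Form α, Form.TNNILOut A.boxTrans P → Form.PresEquiv A.boxTrans P :=
  ⟨Form.exists_tnnilOut _, fun _ h => h.presEquiv (.boxTrans A)⟩
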